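/- Let $X$ be a topological space and $A$ an abelian group; $H^*(-;A)$ denotes singular cohomology, and path spaces carry the compact-open topology. Notation. Let $PX=C([0,1],X)$, $\pi\colon PX\to X\times X$, $\pi(\gamma)=(\gamma(0),\gamma(1))$, and let $LX=\{\gamma\in PX : \gamma(0)=\gamma(1)\}$ be the free loop space. Let $r_1,r_2\colon LX\to PX$ be $r_1(\gamma)(t)=\gamma(t/2)$ and $r_2(\gamma)(t)=\gamma(1-t/2)$. Let $P_2X$ be the double mapping cylinder of $r_1$ and $r_2$, i.e. the quotient of $(LX\times[1,2])\amalg(PX\times\{1\})\amalg(PX\times\{2\})$ by the equivalence relation generated by $(\gamma,1)\sim(r_1(\gamma),1)$ and $(\gamma,2)\sim(r_2(\gamma),2)$ for $\gamma\in LX$, and let $\pi_2\colon P_2X\to X\times X$ be the map with $[\gamma,t]\mapsto(\gamma(0),\gamma(1/2))$ on $LX\times[1,2]$ and $[\gamma,j]\mapsto(\gamma(0),\gamma(1))$ on the two copies of $PX$. For a singular cochain $c\in C^2(X;A)$ define $b_c\in C^1(PX;A)$ on a singular simplex $\sigma\colon\Delta_1\to PX$ by $$b_c(\sigma)=c(\Psi(\sigma)\circ\iota_0)-c(\Psi(\sigma)\circ\iota_1),$$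 where $\Psi(\sigma)\colon\Delta_1\times[0,1]\to X$, $\Psi(\sigma)(x,s)=\sigma(x)(s)$, and $\iota_j\colon\Delta_2\to\Delta_1\times[0,1]$ is the affine map with $\iota_j(v_i)=(v_i,0)$ for $i\le j$ and $\iota_j(v_i)=(v_{i-1},1)$ for $i>j$. Put $a_c=r_1^*b_c-r_2^*b_c\in C^1(LX;A)$ and $\overline c=\mathrm{pr}_2^*c-\mathrm{pr}_1^*c\in C^2(X\times X;A)$. A class $u\in H^k(X;A)$ is atoroidal if $f^*u=0\in H^k(T^k;A)$ for every continuous map $f\colon T^k=(S^1)^k\to X$. The TC-weight $\mathrm{wgt}(u)\in\{0,1,\dots\}\cup\{\infty\}$ of $u\in H^*(X\times X;A)$ is the largest $k$ such that $f^*u=0$ for every continuous map $f\colon Y\to X\times X$ for which $Y$ has an open cover $U_1,\dots,U_k$ and there are continuous maps $f_i\colon U_i\to PX$ with $\pi\circ f_i=f|_{U_i}$ for all $i$ (and $\mathrm{wgt}(u)=\infty$ if there is no largest such $k$). Proposition. Let $c\in C^2(X;A)$ be a singular cocycle representing an atoroidal cohomology class. Then: 1. $a_c$ is a cocycle and $[a_c]=0\in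 H^1(LX;A)$; 2. $\pi_2^*[\overline c]=0\in H^2(P_2X;A)$; 3. $\mathrm{wgt}([\overline c])\ge 2$, and $\mathrm{wgt}([\overline c])=2$ if $[\overline c]\ne 0\in H^2(X\times X;A)$. -/

import Mathlib

namespace TCWeight

universe u v w

noncomputable section

/-! ### Singular cohomology with coefficients in an abelian group -/

/-- The standard `n`-simplex, spanned by the vertices indexed by `Fin (n + 1)`. -/
abbrev Simplex (n : ℕ) : Type := stdSimplex ℝ (Fin (n + 1))

/-- The affine map of standard simplices induced by a map of vertices. -/
def simplexMap {m n : ℕ} (g : Fin (m + 1) → Fin (n + 1)) : C(Simplex m, Simplex n) where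
  toFun := stdSimplex.map g
  continuous_toFun := stdSimplex.continuous_map g

/-- The inclusion of the face opposite to the `i`-th vertex. -/
def face {n : ℕ} (i : Fin (n + 2)) : C(Simplex n, Simplex (n + 1)) :=
  simplexMap i.succAbove

/-- Singular `n`-cochains: homomorphisms from the free abelian group on the singular `n`-simplices
to `A`, that is, arbitrary functions on the set of singular `n`-simplices. -/
abbrev Cochain (n : ℕ) (X : Type u) [TopologicalSpace X] (A : Type v) : Type (max u v) :=
  C(Simplex n, X) → A

section Cohomology

variable {X : Type u} [TopologicalSpace X] {Y : Type w} [TopologicalSpace Y]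
  {A : Type v} [AddCommGroup A]

/-- The singular coboundary `(δ φ)(σ) = ∑ i, (-1) ^ i φ(σ ∘ face i)`. -/
def coboundary (n : ℕ) : Cochain n X A →+ Cochain (n + 1) X A where
  toFun φ σ := ∑ i : Fin (n + 2), (-1 : ℤ) ^ (i : ℕ) • φ (σ.comp (face i))
  map_zero' := by ext σ; simp
  map_add' φ ψ := by ext σ; simp [smul_add, Finset.sum_add_distrib]

/-- Pullback of singular cochains along a continuous map. -/
def cochainMap (n : ℕ) (f : C(X, Y)) : Cochain n Y A →+ Cochain n X A where
  toFun φ σ := φ (f.comp σ)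
  map_zero' := rfl
  map_add' _ _ := rfl

theorem coboundary_cochainMap (n : ℕ) (f : C(X, Y)) (φ : Cochain n Y A) :
    coboundary n (cochainMap n f φ) = cochainMap (n + 1) f (coboundary n φ) := rfl

variable (X A) in
/-- Singular `n`-cocycles. -/
def cocycles (n : ℕ) : AddSubgroup (Cochain n X A) := (coboundary n).ker

variable (X A) in
/-- Singular `n`-coboundaries (there are no nonzero ones in degree `0`). -/
def coboundaries : (n : ℕ) → AddSubgroup (Cochain n X A)
  | 0 => ⊥
  | n + 1 => (coboundary n).range

variable (X A) in
/-- The singular cohomology group `H^n(X; A)`: cocycles modulo coboundaries. -/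
abbrev Cohomology (n : ℕ) : Type (max u v) :=
  cocycles X A n ⧸ (coboundaries X A n).addSubgroupOf (cocycles X A n)

/-- The cohomology class of a cocycle. -/
def cohomologyClass (n : ℕ) : cocycles X A n →+ Cohomology X A n :=
  QuotientAddGroup.mk' _

theorem cochainMap_mem_cocycles (n : ℕ) (f : C(X, Y)) {φ : Cochain n Y A}
    (h : φ ∈ cocycles Y A n) : cochainMap n f φ ∈ cocycles X A n := by
  have h' : coboundary n φ = 0 := h
  change coboundary n (cochainMap n f φ) = 0
  rw [coboundary_cochainMap, h', map_zero]

theorem cochainMap_mem_coboundaries (n : ℕ) (f : C(X, Y)) {φ : Cochain n Y A}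
    (h : φ ∈ coboundaries Y A n) : cochainMap n f φ ∈ coboundaries X A n := by
  cases n with
  | zero =>
    have h' : φ = 0 := h
    rw [h', map_zero]
    exact zero_mem _
  | succ n =>
    obtain ⟨ψ, rfl⟩ := h
    exact ⟨cochainMap n f ψ, coboundary_cochainMap n f ψ⟩

/-- Pullback of singular cocycles. -/
def cocyclesMap (n : ℕ) (f : C(X, Y)) : cocycles Y A n →+ cocycles X A n :=
  ((cochainMap n f).comp (cocycles Y A n).subtype).codRestrict _
    fun φ => cochainMap_mem_cocycles n f φ.2

/-- The homomorphism `f^* : H^n(Y; A) → H^n(X; A)` induced by a continuous map `f : X → Y`. -/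
def cohomologyMap (n : ℕ) (f : C(X, Y)) : Cohomology Y A n →+ Cohomology X A n :=
  QuotientAddGroup.map _ _ (cocyclesMap n f) fun _ h => cochainMap_mem_coboundaries n f h

/-- The `k`-dimensional torus. -/
abbrev Torus (k : ℕ) : Type := Fin k → UnitAddCircle

/-- A class of degree `k` is atoroidal if it pulls back to zero along every map from the
`k`-dimensional torus. -/
def IsAtoroidal {k : ℕ} (u : Cohomology X A k) : Prop :=
  ∀ f : C(Torus k, X), cohomologyMap k f u = 0

end Cohomology

/-! ### Path space, free loop space and fiberwise join -/

/-- The path space `PX`, with the compact-open topology. -/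
abbrev PathSpace (X : Type u) [TopologicalSpace X] : Type u := C(unitInterval, X)

/-- The free loop space `LX`, as a subspace of `PX`. -/
abbrev LoopSpace (X : Type u) [TopologicalSpace X] : Type u :=
  {γ : PathSpace X // γ 0 = γ 1}

section Spaces

variable {X : Type u} [TopologicalSpace X]

/-- The end point map `π : PX → X × X`. -/
def endpoints : C(PathSpace X, X × X) where
  toFun γ := (γ 0, γ 1)
  continuous_toFun := by fun_prop

/-- The map `ψ₁(t) = t / 2`. -/
def psi₁ : C(unitInterval, unitInterval) where
  toFun t := ⟨t / 2, by have := t.2.1; have := t.2.2; constructor <;> linarith⟩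
  continuous_toFun := by fun_prop

/-- The map `ψ₂(t) = 1 - t / 2`. -/
def psi₂ : C(unitInterval, unitInterval) where
  toFun t := ⟨1 - t / 2, by have := t.2.1; have := t.2.2; constructor <;> linarith⟩
  continuous_toFun := by fun_prop

/-- `r₁ : LX → PX` sends a loop to its first half. -/
def r₁ : C(LoopSpace X, PathSpace X) where
  toFun γ := γ.1.comp psi₁
  continuous_toFun := (ContinuousMap.continuous_precomp psi₁).comp continuous_subtype_val

/-- `r₂ : LX → PX` sends a loop to its second half, with reversed orientation. -/
def r₂ : C(LoopSpace X, PathSpace X) where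
  toFun γ := γ.1.comp psi₂
  continuous_toFun := (ContinuousMap.continuous_precomp psi₂).comp continuous_subtype_val

theorem endpoints_r₁_eq_endpoints_r₂ (γ : LoopSpace X) : endpoints (r₁ γ) = endpoints (r₂ γ) := by
  have h0 : psi₁ 0 = 0 := by ext; simp [psi₁]
  have h1 : psi₂ 0 = 1 := by ext; simp [psi₂]
  have h2 : psi₁ 1 = psi₂ 1 := by ext; simp [psi₁, psi₂]; norm_num
  have h := γ.2
  simp [endpoints, r₁, r₂, h0, h1, h2, h]

variable (X) in
/-- The disjoint union of `LX × [1, 2]` and two copies of `PX` (the copies `PX × {1}` and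
`PX × {2}`). -/
abbrev PreJoin : Type u :=
  (LoopSpace X × Set.Icc (1 : ℝ) 2) ⊕ (PathSpace X ⊕ PathSpace X)

variable (X) in
/-- The gluing relation `(γ, 1) ∼ (r₁ γ, 1)` and `(γ, 2) ∼ (r₂ γ, 2)` of the double mapping
cylinder. -/
inductive JoinRel : PreJoin X → PreJoin X → Prop
  | left (γ : LoopSpace X) :
      JoinRel (Sum.inl (γ, ⟨1, by norm_num⟩)) (Sum.inr (Sum.inl (r₁ γ)))
  | right (γ : LoopSpace X) :
      JoinRel (Sum.inl (γ, ⟨2, by norm_num⟩)) (Sum.inr (Sum.inr (r₂ γ)))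

variable (X) in
/-- The fiberwise join `P₂X`: the double mapping cylinder of `r₁` and `r₂`, that is the quotient
space by the equivalence relation generated by `JoinRel`. -/
def FiberwiseJoin : Type u := Quot (JoinRel X)

instance : TopologicalSpace (FiberwiseJoin X) :=
  inferInstanceAs (TopologicalSpace (Quot (JoinRel X)))

variable (X) in
/-- The map `(γ, t) ↦ (γ(0), γ(1/2))` on `LX × [1, 2]` and `γ ↦ (γ(0), γ(1))` on the copies
of `PX`. -/
def preEndpoints : PreJoin X → X × X :=
  Sum.elim (fun p => (p.1.1 0, p.1.1 ⟨1 / 2, by constructor <;> norm_num⟩))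
    (Sum.elim (fun γ => (γ 0, γ 1)) (fun γ => (γ 0, γ 1)))

theorem continuous_preEndpoints : Continuous (preEndpoints X) := by
  refine Continuous.sumElim ?_ (Continuous.sumElim ?_ ?_) <;> fun_prop

theorem preEndpoints_eq_of_joinRel (p q : PreJoin X) (h : JoinRel X p q) :
    preEndpoints X p = preEndpoints X q := by
  have h0 : psi₁ 0 = 0 := by ext; simp [psi₁]
  have h1 : psi₂ 0 = 1 := by ext; simp [psi₂]
  have h2 : psi₁ 1 = ⟨1 / 2, by constructor <;> norm_num⟩ := by ext; simp [psi₁]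
  have h3 : psi₂ 1 = ⟨1 / 2, by constructor <;> norm_num⟩ := by ext; simp [psi₂]; norm_num
  cases h with
  | left γ => simp [preEndpoints, r₁, h0, h2]
  | right γ => simp [preEndpoints, r₂, h1, h3, γ.2]

variable (X) in
/-- The projection `π₂ : P₂X → X × X`. -/
def joinProj : C(FiberwiseJoin X, X × X) where
  toFun := Quot.lift (preEndpoints X) preEndpoints_eq_of_joinRel
  continuous_toFun := continuous_quot_lift preEndpoints_eq_of_joinRel continuous_preEndpoints

end Spaces

/-! ### Transfer of cochains to the path space -/

section Transfer

variable {X : Type u} [TopologicalSpace X] {A : Type v} [AddCommGroup A]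

/-- The function `x ↦ ∑ i > j, x i` on the standard simplex: the affine function to `[0, 1]` with
value `0` on the vertices `v i`, `i ≤ j`, and value `1` on the vertices `v i`, `i > j`. -/
def heightAbove {n : ℕ} (j : Fin (n + 1)) : C(Simplex n, unitInterval) where
  toFun x := ⟨∑ i ∈ Finset.Ioi j, x i,
    Finset.sum_nonneg fun i _ => stdSimplex.zero_le x i,
    (Finset.sum_le_sum_of_subset_of_nonneg (Finset.subset_univ _)
      fun i _ _ => stdSimplex.zero_le x i).trans_eq (stdSimplex.sum_eq_one x)⟩
  continuous_toFun := by
    refine Continuous.subtype_mk (continuous_finsetSum _ fun i _ => ?_) _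
    exact (continuous_apply i).comp continuous_subtype_val

/-- The affine embedding `ι_j : Δ_{k+1} → Δ_k × [0, 1]` with `v_i ↦ (v_i, 0)` for `i ≤ j` and
`v_i ↦ (v_{i-1}, 1)` for `i > j`. -/
def prism {k : ℕ} (j : Fin (k + 1)) : C(Simplex (k + 1), Simplex k × unitInterval) :=
  (simplexMap j.predAbove).prodMk (heightAbove j.castSucc)

/-- The exponential law: the map `Ψ(σ)(x, s) = σ(x)(s)`. -/
def uncurryPath {k : ℕ} (σ : C(Simplex k, PathSpace X)) : C(Simplex k × unitInterval, X) :=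
  σ.uncurry

/-- The transfer `c ↦ b_c` from cochains on `X` to cochains on `PX`, given by
`b_c(σ) = ∑ j, (-1) ^ j c(Ψ(σ) ∘ ι_j)`. For `k = 1` this is `c(Ψ(σ) ∘ ι_0) - c(Ψ(σ) ∘ ι_1)`. -/
def transfer (k : ℕ) (c : Cochain (k + 1) X A) : Cochain k (PathSpace X) A :=
  fun σ => ∑ j : Fin (k + 1), (-1 : ℤ) ^ (j : ℕ) • c ((uncurryPath σ).comp (prism j))

/-- The cochain `a_c = r₁^* b_c - r₂^* b_c` on the free loop space. -/
def loopCochain (c : Cochain 2 X A) : Cochain 1 (LoopSpace X) A :=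
  cochainMap 1 r₁ (transfer 1 c) - cochainMap 1 r₂ (transfer 1 c)

/-- The cocycle `pr₂^* c - pr₁^* c` on `X × X`. -/
def zeroDivisor {n : ℕ} (c : cocycles X A n) : cocycles (X × X) A n :=
  cocyclesMap n ContinuousMap.snd c - cocyclesMap n ContinuousMap.fst c

end Transfer

/-! ### TC-weight -/

section Weight

variable {X : Type u} [TopologicalSpace X] {A : Type v} [AddCommGroup A]

/-- `f^* u = 0` for every `f : Y → X × X` such that `Y` has an open cover by `k` sets over each of
which `f` lifts to `PX`. -/
def VanishesOnCovers {n : ℕ} (u : Cohomology (X × X) A n) (k : ℕ) : Prop :=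
  ∀ (Y : Type u) [TopologicalSpace Y] (f : C(Y, X × X)) (U : Fin k → Set Y),
    (∀ i, IsOpen (U i)) → (⋃ i, U i) = Set.univ →
    (∀ i, ∃ s : C(U i, PathSpace X), ∀ y : U i, endpoints (s y) = f y) →
    cohomologyMap n f u = 0

/-- The TC-weight of `u ∈ H^n(X × X; A)`: the largest `k` with `VanishesOnCovers u k`, and `∞` if
there is no largest one. -/
def tcWeight {n : ℕ} (u : Cohomology (X × X) A n) : ℕ∞ :=
  ⨆ (k : ℕ) (_ : VanishesOnCovers u k), (k : ℕ∞)

end Weight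

end

end TCWeight

/-! The prism operator `c ↦ b_c` is a cochain homotopy between the evaluations of paths at their two
ends, so `δ b_c = ev₁^* c - ev₀^* c` on `PX` for a cocycle `c` (`coboundary_transfer_two`). The two
halves of a loop have the same end points, hence `a_c` is a cocycle. A 1-cocycle is exact once it
vanishes on closed 1-simplices (`mem_coboundaries_one_of_closed`), and a closed 1-simplex of `LX` is
adjoint to a map `f` from a torus. Its value under `a_c` is a value of `a_{f^* c}` on a closed
simplex. Since `c` is atoroidal, `f^* c` is exact; then so is `a_{f^* c}`, and the value is zero.

For weight at least 2, let `s₀`, `s₁` be lifts over `U₀`, `U₁`. The cochains `s_i^* b_c` are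
primitives of the pullback of `pr₂^* c - pr₁^* c` over `U_i`. Over the intersection the lifts form a
map to `LX`, along which the difference of the primitives is the pullback of `a_c = δ g`. Correcting
one of them by the coboundary of `g`, extended by zero, yields a global cochain; subtracting its
coboundary leaves a cocycle that vanishes on simplices inside one `U_i`. Such a cocycle is exact
(`mem_coboundaries_two_of_small`): instead of subdividing, one uses a unique primitive on each
simplex that vanishes on short segments. As `P₂X` is itself covered by two open sets with lifts, the
vanishing of `π₂^*` is a special case.

For the upper bound, consider the 2-skeleton of the singular complex with the map `y ↦ (base point,
y)`. The stars of the barycenters of vertices, edges and triangles form three open sets over which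
this map lifts to `PX`. Vanishing on covers by `k ≥ 3` sets therefore makes `c` exact up to constant
simplices, hence exact (`mem_coboundaries_of_vanishesOnCovers`). -/

open Set Topology

namespace TCWeight

universe u v w

noncomputable section

/-! ### Affine maps of simplices -/

section Affine

variable {m n k : ℕ}

/-- The vertices of the standard simplex. -/
abbrev vtx (i : Fin (n + 1)) : Simplex n := stdSimplex.vertex i

theorem continuous_coord (i : Fin (n + 1)) : Continuous fun x : Simplex n => x i :=
  (continuous_apply i).comp continuous_subtype_val

/-- Summation over the fibres of `g`. The compatibility of affine maps with vertex maps and the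
coordinates of faces all come from this identity. -/
theorem sum_simplexMap (g : Fin (m + 1) → Fin (n + 1)) (x : Simplex m) (q : Fin (n + 1) → ℝ) :
    ∑ j, simplexMap g x j * q j = ∑ i, x i * q (g i) := by
  change ∑ j, stdSimplex.map g x j * q j = _
  simp only [stdSimplex.map_coe, FunOnFinite.linearMap_apply_apply, Finset.sum_mul]
  rw [← Finset.sum_fiberwise Finset.univ g]
  refine Finset.sum_congr rfl fun j _ => Finset.sum_congr rfl fun i hi => ?_
  rw [(Finset.mem_filter.1 hi).2]

/-- The affine function on the simplex with prescribed values on the vertices. -/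
def height (h : Fin (m + 1) → unitInterval) : C(Simplex m, unitInterval) where
  toFun x := ⟨∑ i, x i * h i,
    Finset.sum_nonneg fun i _ => mul_nonneg (stdSimplex.zero_le x i) (h i).2.1,
    (Finset.sum_le_sum fun i _ =>
      mul_le_of_le_one_right (stdSimplex.zero_le x i) (h i).2.2).trans_eq
      (stdSimplex.sum_eq_one x)⟩
  continuous_toFun := by
    refine Continuous.subtype_mk (continuous_finsetSum _ fun i _ => ?_) _
    exact (continuous_coord i).mul continuous_const

theorem coe_height (h : Fin (m + 1) → unitInterval) (x : Simplex m) :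
    (height h x : ℝ) = ∑ i, x i * h i := rfl

theorem height_simplexMap (h : Fin (n + 1) → unitInterval) (g : Fin (m + 1) → Fin (n + 1)) :
    (height h).comp (simplexMap g) = height (h ∘ g) := by
  ext x
  exact sum_simplexMap g x fun j => (h j : ℝ)

theorem height_const (a : unitInterval) : height (fun _ : Fin (m + 1) => a) = .const _ a := by
  ext x
  simp [coe_height, ← Finset.sum_mul]

/-- The affine singular simplex with prescribed vertices. -/
def affineSimplex (p : Fin (m + 1) → Simplex n) : C(Simplex m, Simplex n) where
  toFun x := ⟨fun j => ∑ i, x i * p i j,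
    fun j => Finset.sum_nonneg fun i _ =>
      mul_nonneg (stdSimplex.zero_le x i) (stdSimplex.zero_le (p i) j), by
    rw [Finset.sum_comm]
    simp [← Finset.mul_sum]⟩
  continuous_toFun := by
    refine Continuous.subtype_mk (continuous_pi fun j => continuous_finsetSum _ fun i _ => ?_) _
    exact (continuous_coord i).mul continuous_const

theorem affineSimplex_apply (p : Fin (m + 1) → Simplex n) (x : Simplex m) (j : Fin (n + 1)) :
    affineSimplex p x j = ∑ i, x i * p i j := rfl

theorem affineSimplex_simplexMap (p : Fin (n + 1) → Simplex k) (g : Fin (m + 1) → Fin (n + 1)) :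
    (affineSimplex p).comp (simplexMap g) = affineSimplex (p ∘ g) := by
  ext x j
  exact sum_simplexMap g x fun i => p i j

theorem affineSimplex_vtx : affineSimplex (vtx (n := n)) = .id _ := by
  ext x j
  change ∑ i, x i * vtx i j = x j
  simp [Pi.single_apply]

theorem simplexMap_affineSimplex (g : Fin (n + 1) → Fin (k + 1)) (p : Fin (m + 1) → Simplex n) :
    (simplexMap g).comp (affineSimplex p) = affineSimplex fun i => simplexMap g (p i) := by
  ext x j
  change stdSimplex.map g (affineSimplex p x) j = ∑ i, x i * stdSimplex.map g (p i) j
  simp only [stdSimplex.map_coe, FunOnFinite.linearMap_apply_apply]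
  simp only [Finset.mul_sum]
  rw [Finset.sum_comm]
  rfl

theorem simplexMap_comp (g : Fin (n + 1) → Fin (k + 1)) (h : Fin (m + 1) → Fin (n + 1)) :
    (simplexMap g).comp (simplexMap h) = simplexMap (g ∘ h) := by
  ext1 x
  exact stdSimplex.map_comp_apply h g x

theorem simplexMap_id : simplexMap (id : Fin (n + 1) → Fin (n + 1)) = .id _ := by
  ext1 x
  exact stdSimplex.map_id_apply x

theorem simplexMap_vtx (g : Fin (m + 1) → Fin (n + 1)) (i : Fin (m + 1)) :
    simplexMap g (vtx i) = vtx (g i) :=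
  stdSimplex.map_vertex g i

theorem height_vtx (h : Fin (m + 1) → unitInterval) (i : Fin (m + 1)) :
    height h (vtx i) = h i := by
  ext
  rw [coe_height]
  simp [Pi.single_apply]

/-- The affine map `Δ_m → Δ_n × [0, 1]` sending the `i`-th vertex to `(v (l i).1, 0)` or
`(v (l i).1, 1)`, according to the truth value `(l i).2`. -/
def prismMap (l : Fin (m + 1) → Fin (n + 1) × Bool) : C(Simplex m, Simplex n × unitInterval) :=
  (simplexMap fun i => (l i).1).prodMk (height fun i => if (l i).2 then 1 else 0)

/-- Encoding prisms by lists of labelled vertices turns taking faces into composition of lists. -/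
theorem prism_eq (j : Fin (n + 1)) :
    prism j = prismMap fun i => (j.predAbove i, decide (j.castSucc < i)) := by
  ext1 x
  refine Prod.ext rfl (Subtype.ext ?_)
  change ∑ i ∈ Finset.Ioi j.castSucc, x i = ∑ i, x i * _
  have : Finset.Ioi j.castSucc = Finset.univ.filter (j.castSucc < ·) := by ext; simp
  rw [this, Finset.sum_filter]
  refine Finset.sum_congr rfl fun i _ => ?_
  by_cases hi : j.castSucc < i
  · simp [hi]
  · simp [hi]

theorem prismMap_simplexMap (l : Fin (n + 1) → Fin (k + 1) × Bool)
    (f : Fin (m + 1) → Fin (n + 1)) :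
    (prismMap l).comp (simplexMap f) = prismMap (l ∘ f) := by
  have h := height_simplexMap (fun i => if (l i).2 then 1 else 0) f
  have h' := simplexMap_comp (fun i => (l i).1) f
  ext1 x
  exact Prod.ext (DFunLike.congr_fun h' x) (DFunLike.congr_fun h x)

end Affine

/-! ### The transfer is a cochain homotopy between the two evaluations -/

section Homotopy

variable {X : Type u} [TopologicalSpace X] {Y : Type w} [TopologicalSpace Y]
  {A : Type v} [AddCommGroup A] {k m n : ℕ}

/-- Evaluation of paths at a time. -/
def evalAt (t : unitInterval) : C(PathSpace X, X) where
  toFun γ := γ t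
  continuous_toFun := by fun_prop

/-- The affine simplex of a prism, composed with the map `Ψ(σ)`. -/
def prismSimplex (σ : C(Simplex n, PathSpace X)) (l : Fin (m + 1) → Fin (n + 1) × Bool) :
    C(Simplex m, X) :=
  (uncurryPath σ).comp (prismMap l)

theorem prismSimplex_simplexMap (σ : C(Simplex n, PathSpace X))
    (l : Fin (m + 1) → Fin (n + 1) × Bool) (f : Fin (k + 1) → Fin (m + 1)) :
    (prismSimplex σ l).comp (simplexMap f) = prismSimplex σ (l ∘ f) := by
  rw [prismSimplex, ContinuousMap.comp_assoc, prismMap_simplexMap]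
  rfl

theorem prismSimplex_comp (σ : C(Simplex n, PathSpace X)) (f : Fin (k + 1) → Fin (n + 1))
    (l : Fin (m + 1) → Fin (k + 1) × Bool) :
    prismSimplex (σ.comp (simplexMap f)) l = prismSimplex σ fun i => (f (l i).1, (l i).2) := by
  have h := simplexMap_comp f fun i => (l i).1
  ext1 x
  change σ (((simplexMap f).comp (simplexMap fun i => (l i).1)) x) _ = σ (simplexMap _ x) _
  rw [h]
  rfl

theorem prismSimplex_const (σ : C(Simplex n, PathSpace X)) (b : Bool) :
    prismSimplex σ (fun i => (i, b)) = (evalAt (if b then 1 else 0)).comp σ := by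
  have h := simplexMap_id (n := n)
  ext1 x
  change σ (simplexMap id x) (height (fun _ => if b then 1 else 0) x) = _
  rw [h, height_const]
  rfl

theorem transfer_apply (c : Cochain (k + 1) X A) (σ : C(Simplex k, PathSpace X)) :
    transfer k c σ = ∑ j : Fin (k + 1), (-1 : ℤ) ^ (j : ℕ) •
      c (prismSimplex σ fun i => (j.predAbove i, decide (j.castSucc < i))) := by
  simp only [transfer, prism_eq]
  rfl

theorem coboundary_apply (c : Cochain k X A) (σ : C(Simplex (k + 1), X)) :
    coboundary k c σ = ∑ i : Fin (k + 2), (-1 : ℤ) ^ (i : ℕ) • c (σ.comp (face i)) := rfl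

/-- With the low-degree faces and prisms written out as vertex lists, the prism identities become
formal identities in an abelian group. -/
theorem coboundary_zero_apply (c : Cochain 0 X A) (σ : C(Simplex 1, X)) :
    coboundary 0 c σ = c (σ.comp (simplexMap ![1])) - c (σ.comp (simplexMap ![0])) := by
  have h0 : (0 : Fin 2).succAbove = ![1] := by decide
  have h1 : (1 : Fin 2).succAbove = ![0] := by decide
  simp [coboundary, Fin.sum_univ_two, face, h0, h1, sub_eq_add_neg]

theorem coboundary_one_apply (c : Cochain 1 X A) (σ : C(Simplex 2, X)) :
    coboundary 1 c σ = c (σ.comp (simplexMap ![1, 2])) - c (σ.comp (simplexMap ![0, 2])) +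
      c (σ.comp (simplexMap ![0, 1])) := by
  have h0 : (0 : Fin 3).succAbove = ![1, 2] := by decide
  have h1 : (1 : Fin 3).succAbove = ![0, 2] := by decide
  have h2 : (2 : Fin 3).succAbove = ![0, 1] := by decide
  simp [coboundary, Fin.sum_univ_three, face, h0, h1, h2, sub_eq_add_neg]

theorem coboundary_two_apply (c : Cochain 2 X A) (σ : C(Simplex 3, X)) :
    coboundary 2 c σ = c (σ.comp (simplexMap ![1, 2, 3])) - c (σ.comp (simplexMap ![0, 2, 3])) +
      c (σ.comp (simplexMap ![0, 1, 3])) - c (σ.comp (simplexMap ![0, 1, 2])) := by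
  have h0 : (0 : Fin 4).succAbove = ![1, 2, 3] := by decide
  have h1 : (1 : Fin 4).succAbove = ![0, 2, 3] := by decide
  have h2 : (2 : Fin 4).succAbove = ![0, 1, 3] := by decide
  have h3 : (3 : Fin 4).succAbove = ![0, 1, 2] := by decide
  have hp : (-1 : ℤ) ^ 3 = -1 := by norm_num
  simp [coboundary, Fin.sum_univ_four, face, h0, h1, h2, h3, hp, sub_eq_add_neg]

theorem transfer_zero_apply (c : Cochain 1 X A) (σ : C(Simplex 0, PathSpace X)) :
    transfer 0 c σ = c (prismSimplex σ ![(0, false), (0, true)]) := by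
  have h0 : (fun i : Fin 2 => ((0 : Fin 1).predAbove i, decide ((0 : Fin 1).castSucc < i))) =
    ![(0, false), (0, true)] := by decide
  refine (transfer_apply c σ).trans ((Fin.sum_univ_one _).trans ?_)
  rw [h0]
  simp

theorem transfer_one_apply (c : Cochain 2 X A) (σ : C(Simplex 1, PathSpace X)) :
    transfer 1 c σ = c (prismSimplex σ ![(0, false), (0, true), (1, true)]) -
      c (prismSimplex σ ![(0, false), (1, false), (1, true)]) := by
  have h0 : (fun i : Fin 3 => ((0 : Fin 2).predAbove i, decide ((0 : Fin 2).castSucc < i))) =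
    ![(0, false), (0, true), (1, true)] := by decide
  have h1 : (fun i : Fin 3 => ((1 : Fin 2).predAbove i, decide ((1 : Fin 2).castSucc < i))) =
    ![(0, false), (1, false), (1, true)] := by decide
  refine (transfer_apply c σ).trans ((Fin.sum_univ_two _).trans ?_)
  rw [h0, h1]
  simp [sub_eq_add_neg]

theorem transfer_two_apply (c : Cochain 3 X A) (σ : C(Simplex 2, PathSpace X)) :
    transfer 2 c σ = c (prismSimplex σ ![(0, false), (0, true), (1, true), (2, true)]) -
      c (prismSimplex σ ![(0, false), (1, false), (1, true), (2, true)]) +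
      c (prismSimplex σ ![(0, false), (1, false), (2, false), (2, true)]) := by
  have h0 : (fun i : Fin 4 => ((0 : Fin 3).predAbove i, decide ((0 : Fin 3).castSucc < i))) =
    ![(0, false), (0, true), (1, true), (2, true)] := by decide
  have h1 : (fun i : Fin 4 => ((1 : Fin 3).predAbove i, decide ((1 : Fin 3).castSucc < i))) =
    ![(0, false), (1, false), (1, true), (2, true)] := by decide
  have h2 : (fun i : Fin 4 => ((2 : Fin 3).predAbove i, decide ((2 : Fin 3).castSucc < i))) =
    ![(0, false), (1, false), (2, false), (2, true)] := by decide
  refine (transfer_apply c σ).trans ((Fin.sum_univ_three _).trans ?_)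
  rw [h0, h1, h2]
  simp [sub_eq_add_neg]

theorem transfer_coboundary_one (e : Cochain 1 X A) :
    transfer 1 (coboundary 1 e) + coboundary 0 (transfer 0 e) =
      cochainMap 1 (evalAt 1) e - cochainMap 1 (evalAt 0) e := by
  funext σ
  have h1 : cochainMap 1 (evalAt 1) e σ = e (prismSimplex σ fun i => (i, true)) := by
    rw [prismSimplex_const]; rfl
  have h0 : cochainMap 1 (evalAt 0) e σ = e (prismSimplex σ fun i => (i, false)) := by
    rw [prismSimplex_const]; rfl
  simp only [Pi.add_apply, Pi.sub_apply, h1, h0, transfer_zero_apply, transfer_one_apply,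
    coboundary_zero_apply, coboundary_one_apply, prismSimplex_simplexMap, prismSimplex_comp]
  -- A prism simplex depends only on its vertex list, so `e` may be replaced by an arbitrary
  -- function of the vertices.
  obtain ⟨F, hF⟩ : ∃ F : Fin 2 × Bool → Fin 2 × Bool → A,
      ∀ l, e (prismSimplex σ l) = F (l 0) (l 1) :=
    ⟨fun a b => e (prismSimplex σ ![a, b]), fun l => by
      congr 2; funext i; fin_cases i <;> rfl⟩
  simp [hF]
  abel

theorem coboundary_transfer_two (c : Cochain 2 X A) (hc : coboundary 2 c = 0) :
    coboundary 1 (transfer 1 c) = cochainMap 2 (evalAt 1) c - cochainMap 2 (evalAt 0) c := by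
  funext σ
  have h1 : cochainMap 2 (evalAt 1) c σ = c (prismSimplex σ fun i => (i, true)) := by
    rw [prismSimplex_const]; rfl
  have h0 : cochainMap 2 (evalAt 0) c σ = c (prismSimplex σ fun i => (i, false)) := by
    rw [prismSimplex_const]; rfl
  -- Adding this vanishing term completes the left side to the full prism identity, which holds for
  -- every cochain.
  have hz : transfer 2 (coboundary 2 c) σ = 0 := by simp [hc, transfer]
  rw [← add_zero (coboundary 1 (transfer 1 c) σ), ← hz]
  simp only [Pi.sub_apply, h1, h0, transfer_one_apply, transfer_two_apply,
    coboundary_one_apply, coboundary_two_apply, prismSimplex_simplexMap, prismSimplex_comp]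
  obtain ⟨F, hF⟩ : ∃ F : Fin 3 × Bool → Fin 3 × Bool → Fin 3 × Bool → A,
      ∀ l, c (prismSimplex σ l) = F (l 0) (l 1) (l 2) :=
    ⟨fun a b d => c (prismSimplex σ ![a, b, d]), fun l => by
      congr 2; funext i; fin_cases i <;> rfl⟩
  simp [hF]
  abel

end Homotopy

/-! ### Path components and cocycles of degree one -/

section DegreeOne

variable {X : Type u} [TopologicalSpace X] {A : Type v} [AddCommGroup A] {n : ℕ}

/-- A base point in the path component of a given point. -/
def basePoint (x : X) : X := Quotient.out (s := pathSetoid X) ⟦x⟧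

theorem basePoint_joined (x : X) : Joined (basePoint x) x :=
  Quotient.mk_out (s := pathSetoid X) x

/-- A path from the base point of its path component to a given point. -/
def basePath (x : X) : Path (basePoint x) x := (basePoint_joined x).somePath

theorem basePoint_eq {x y : X} (h : Joined x y) : basePoint x = basePoint y :=
  congrArg Quotient.out (Quotient.sound (s := pathSetoid X) h)

theorem comp_simplexMap_vertex (σ : C(Simplex n, X)) (i : Fin (n + 1)) :
    σ.comp (simplexMap ![i]) = .const (Simplex 0) (σ (vtx i)) := by
  ext1 x
  have hx : x = vtx 0 := Subsingleton.elim _ _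
  subst hx
  exact congrArg σ (simplexMap_vtx ![i] 0)

/-- The parametrization of the standard `1`-simplex by the unit interval. -/
def unitPoint : C(unitInterval, Simplex 1) where
  toFun t := ⟨![1 - t, t], by
    refine ⟨fun i => ?_, by simp [Fin.sum_univ_two]⟩
    fin_cases i
    · simpa using t.2.2
    · simpa using t.2.1⟩
  continuous_toFun := by
    refine Continuous.subtype_mk (continuous_pi fun i => ?_) _
    fin_cases i
    · exact continuous_const.sub continuous_subtype_val
    · exact continuous_subtype_val

theorem unitPoint_zero : unitPoint 0 = vtx 0 := by
  ext i
  change (![1 - ((0 : unitInterval) : ℝ), ((0 : unitInterval) : ℝ)] : Fin 2 → ℝ) i = vtx 0 i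
  fin_cases i <;> simp

theorem unitPoint_one : unitPoint 1 = vtx 1 := by
  ext i
  change (![1 - ((1 : unitInterval) : ℝ), ((1 : unitInterval) : ℝ)] : Fin 2 → ℝ) i = vtx 1 i
  fin_cases i <;> simp

theorem unitPoint_height (x : Simplex 1) : unitPoint (height ![0, 1] x) = x := by
  have h : (height ![0, 1] x : ℝ) = x 1 := by simp [coe_height, Fin.sum_univ_two]
  have hx := stdSimplex.add_eq_one x
  ext i
  change (![1 - (height ![0, 1] x : ℝ), (height ![0, 1] x : ℝ)] : Fin 2 → ℝ) i = x i
  rw [h]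
  fin_cases i
  · simp; linarith
  · simp

/-- A path as a singular `1`-simplex. -/
def pathSimplex {x y : X} (p : Path x y) : C(Simplex 1, X) :=
  p.toContinuousMap.comp (height ![0, 1])

/-- A singular `1`-simplex as a path. -/
def simplexPath (σ : C(Simplex 1, X)) : Path (σ (vtx 0)) (σ (vtx 1)) where
  toContinuousMap := σ.comp unitPoint
  source' := congrArg σ unitPoint_zero
  target' := congrArg σ unitPoint_one

theorem pathSimplex_simplexPath (σ : C(Simplex 1, X)) : pathSimplex (simplexPath σ) = σ := by
  ext1 x
  exact congrArg σ (unitPoint_height x)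

/-- The affine function with vertex values `0`, `1/2`, `1`, followed by `p.trans q`, is a singular
2-simplex whose edges are `p`, `q` and `p.trans q`; the cocycle condition is evaluated on it. -/
theorem cocycle_trans {a : Cochain 1 X A} (ha : a ∈ cocycles X A 1) {x y z : X}
    (p : Path x y) (q : Path y z) :
    a (pathSimplex (p.trans q)) = a (pathSimplex p) + a (pathSimplex q) := by
  set hf : unitInterval := ⟨1 / 2, by norm_num, by norm_num⟩
  have h := congrFun (show coboundary 1 a = 0 from ha)
    ((p.trans q).toContinuousMap.comp (height ![0, hf, 1]))
  have h01 : (![0, hf, 1] ∘ ![0, 1] : Fin 2 → unitInterval) = ![0, hf] := by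
    funext i; fin_cases i <;> rfl
  have h02 : (![0, hf, 1] ∘ ![0, 2] : Fin 2 → unitInterval) = ![0, 1] := by
    funext i; fin_cases i <;> rfl
  have h12 : (![0, hf, 1] ∘ ![1, 2] : Fin 2 → unitInterval) = ![hf, 1] := by
    funext i; fin_cases i <;> rfl
  have hp : (p.trans q).toContinuousMap.comp (height ![0, hf]) = pathSimplex p := by
    ext t
    have ht := stdSimplex.le_one t 1
    change (p.trans q) (height ![0, hf] t) = p (height ![0, 1] t)
    rw [Path.trans_apply, dif_pos]
    · congr 1
      ext
      simp only [coe_height]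
      simp [hf]
      ring
    · simp [coe_height, Fin.sum_univ_two, hf]
  have hq : (p.trans q).toContinuousMap.comp (height ![hf, 1]) = pathSimplex q := by
    ext t
    have ht := stdSimplex.add_eq_one t
    have ht1 := stdSimplex.zero_le t 1
    have hv : (height ![hf, 1] t : ℝ) = t 0 * (1 / 2) + t 1 := by
      simp [coe_height, Fin.sum_univ_two, hf]
    change (p.trans q) (height ![hf, 1] t) = q (height ![0, 1] t)
    rw [Path.trans_apply]
    split_ifs with h
    -- The first half of the concatenation is met only at its end, the common point of `p` and `q`.
    · have h1 : t 1 = 0 := by linarith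
      have e1 : height ![0, 1] t = 0 := by
        ext
        simp [coe_height, Fin.sum_univ_two, h1]
      rw [e1, q.source]
      convert p.target
      rw [hv, h1]
      simp; linarith
    · congr 1
      ext
      simp [coe_height, Fin.sum_univ_two, hf]
      linarith
  rw [coboundary_one_apply] at h
  simp only [ContinuousMap.comp_assoc, height_simplexMap, h01, h02, h12, hp, hq] at h
  change _ - a (pathSimplex (p.trans q)) + _ = 0 at h
  rw [← sub_eq_zero, ← neg_eq_zero, ← h]
  abel

/-- Vanishing on loops makes the value on a path depend only on its end points, so integration along
paths from a base point of each path component defines a primitive. -/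
theorem mem_coboundaries_one_of_closed {a : Cochain 1 X A} (ha : a ∈ cocycles X A 1)
    (hc : ∀ σ : C(Simplex 1, X), σ (vtx 0) = σ (vtx 1) → a σ = 0) :
    a ∈ coboundaries X A 1 := by
  have hv0 : height ![0, 1] (vtx 0) = 0 := height_vtx _ _
  have hv1 : height ![0, 1] (vtx 1) = 1 := height_vtx _ _
  have hloop {x : X} (p : Path x x) : a (pathSimplex p) = 0 := by
    refine hc _ ?_
    change p (height ![0, 1] (vtx 0)) = p (height ![0, 1] (vtx 1))
    rw [hv0, hv1, p.source, p.target]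
  have hpath {x y : X} (p q : Path x y) : a (pathSimplex p) = a (pathSimplex q) := by
    have h1 := cocycle_trans ha p q.symm
    have h2 := cocycle_trans ha q q.symm
    rw [hloop] at h1 h2
    exact add_right_cancel (h1.symm.trans h2)
  refine ⟨fun ρ => a (pathSimplex (basePath (ρ (vtx 0)))), funext fun σ => ?_⟩
  rw [coboundary_zero_apply, comp_simplexMap_vertex, comp_simplexMap_vertex]
  have hb : basePoint (σ (vtx 0)) = basePoint (σ (vtx 1)) := basePoint_eq ⟨simplexPath σ⟩
  have h := cocycle_trans ha (basePath (σ (vtx 0))) (simplexPath σ)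
  rw [hpath _ ((basePath (σ (vtx 1))).cast hb rfl), pathSimplex_simplexPath] at h
  change a (pathSimplex (basePath (σ (vtx 1)))) - a (pathSimplex (basePath (σ (vtx 0)))) = a σ
  change a (pathSimplex (basePath (σ (vtx 1)))) = _ at h
  rw [h, add_sub_cancel_left]

end DegreeOne

/-! ### The transfer of an atoroidal class to the free loop space -/

section Loops

variable {X : Type u} [TopologicalSpace X] {Y : Type w} [TopologicalSpace Y]
  {A : Type v} [AddCommGroup A] {n : ℕ}

theorem evalAt_r₁_r₂ (t : unitInterval) (ht : t = 0 ∨ t = 1) :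
    (evalAt t).comp (r₁ (X := X)) = (evalAt t).comp r₂ := by
  ext γ
  have h := endpoints_r₁_eq_endpoints_r₂ γ
  rcases ht with rfl | rfl
  · exact congrArg Prod.fst h
  · exact congrArg Prod.snd h

theorem cochainMap_evalAt_r₁_r₂ (t : unitInterval) (ht : t = 0 ∨ t = 1) (φ : Cochain n X A) :
    cochainMap n r₁ (cochainMap n (evalAt t) φ) = cochainMap n r₂ (cochainMap n (evalAt t) φ) :=
  congrArg (fun f => cochainMap n f φ) (evalAt_r₁_r₂ t ht)

theorem loopCochain_mem_cocycles {c : Cochain 2 X A} (hc : c ∈ cocycles X A 2) :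
    loopCochain c ∈ cocycles (LoopSpace X) A 1 := by
  change coboundary 1 (loopCochain c) = 0
  rw [loopCochain, map_sub, coboundary_cochainMap, coboundary_cochainMap,
    coboundary_transfer_two c hc, map_sub, map_sub, cochainMap_evalAt_r₁_r₂ 0 (.inl rfl),
    cochainMap_evalAt_r₁_r₂ 1 (.inr rfl), sub_self]

/-- In the homotopy formula for `e` the evaluation terms agree after `r₁` and `r₂`, so only the
coboundary terms survive the difference. -/
theorem loopCochain_coboundary (e : Cochain 1 X A) :
    loopCochain (coboundary 1 e) =
      coboundary 0 (cochainMap 0 r₂ (transfer 0 e) - cochainMap 0 r₁ (transfer 0 e)) := by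
  have h := eq_sub_of_add_eq (transfer_coboundary_one (X := X) e)
  rw [loopCochain, h]
  simp only [map_sub, coboundary_cochainMap, cochainMap_evalAt_r₁_r₂ 0 (.inl rfl),
    cochainMap_evalAt_r₁_r₂ 1 (.inr rfl)]
  abel

/-- The map of free loop spaces induced by a continuous map. -/
def loopMap (f : C(X, Y)) : C(LoopSpace X, LoopSpace Y) where
  toFun γ := ⟨f.comp γ.1, congrArg f γ.2⟩
  continuous_toFun := by
    refine Continuous.subtype_mk ?_ _
    exact (ContinuousMap.continuous_postcomp f).comp continuous_subtype_val

theorem cochainMap_loopMap (f : C(X, Y)) (c : Cochain 2 Y A) :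
    cochainMap 1 (loopMap f) (loopCochain c) = loopCochain (cochainMap 2 f c) := rfl

/-- The quotient map from the square to the torus. -/
def squareToTorus : C(unitInterval × unitInterval, Torus 2) where
  toFun p := ![((p.1 : ℝ) : UnitAddCircle), ((p.2 : ℝ) : UnitAddCircle)]
  continuous_toFun := by
    refine continuous_pi fun i => ?_
    fin_cases i
    · exact (AddCircle.continuous_mk' 1).comp (continuous_subtype_val.comp continuous_fst)
    · exact (AddCircle.continuous_mk' 1).comp (continuous_subtype_val.comp continuous_snd)

theorem exists_unitInterval_coe_eq (z : UnitAddCircle) :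
    ∃ t : unitInterval, ((t : ℝ) : UnitAddCircle) = z := by
  have h := (AddCircle.equivIco 1 0 z).2
  exact ⟨⟨AddCircle.equivIco 1 0 z, h.1, by linarith [h.2]⟩, AddCircle.coe_equivIco⟩

/-- A continuous surjection from a compact space to a Hausdorff space is a quotient map. -/
theorem isQuotientMap_squareToTorus : IsQuotientMap squareToTorus := by
  refine IsQuotientMap.of_surjective_continuous (fun z => ?_) squareToTorus.continuous
  obtain ⟨s, hs⟩ := exists_unitInterval_coe_eq (z 0)
  obtain ⟨t, ht⟩ := exists_unitInterval_coe_eq (z 1)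
  refine ⟨(s, t), funext fun i => ?_⟩
  fin_cases i
  · exact hs
  · exact ht

theorem unitInterval_coe_eq_coe {s t : unitInterval}
    (h : ((s : ℝ) : UnitAddCircle) = ((t : ℝ) : UnitAddCircle)) :
    s = t ∨ (s = 0 ∧ t = 1) ∨ (s = 1 ∧ t = 0) := by
  rw [← sub_eq_zero, ← AddCircle.coe_sub, AddCircle.coe_eq_zero_iff] at h
  obtain ⟨n, hn⟩ := h
  have hn' : (n : ℝ) = s - t := by simpa using hn
  have hs0 := s.2.1
  have hs1 := s.2.2
  have ht0 := t.2.1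
  have ht1 := t.2.2
  have h1 : (n : ℝ) ≤ 1 := by linarith
  have h2 : (-1 : ℝ) ≤ n := by linarith
  have h1' : n ≤ 1 := by exact_mod_cast h1
  have h2' : -1 ≤ n := by exact_mod_cast h2
  obtain rfl | rfl | rfl : n = -1 ∨ n = 0 ∨ n = 1 := by omega
  · push_cast at hn'
    refine .inr (.inl ⟨Subtype.ext ?_, Subtype.ext ?_⟩)
    · change (s : ℝ) = 0; linarith
    · change (t : ℝ) = 1; linarith
  · push_cast at hn'
    exact .inl (Subtype.ext (by linarith))
  · push_cast at hn'
    refine .inr (.inr ⟨Subtype.ext ?_, Subtype.ext ?_⟩)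
    · change (s : ℝ) = 1; linarith
    · change (t : ℝ) = 0; linarith

theorem squareToTorus_left (s : unitInterval) : squareToTorus (0, s) = squareToTorus (1, s) := by
  funext i
  fin_cases i
  · change (((0 : unitInterval) : ℝ) : UnitAddCircle) = (((1 : unitInterval) : ℝ) : UnitAddCircle)
    have := AddCircle.coe_period (1 : ℝ)
    simpa using this.symm
  · rfl

theorem squareToTorus_right (s : unitInterval) : squareToTorus (s, 0) = squareToTorus (s, 1) := by
  funext i
  fin_cases i
  · rfl
  · change (((0 : unitInterval) : ℝ) : UnitAddCircle) = (((1 : unitInterval) : ℝ) : UnitAddCircle)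
    have := AddCircle.coe_period (1 : ℝ)
    simpa using this.symm

/-- A map from the square that is compatible with the identifications of opposite sides descends
to the torus. -/
theorem exists_torus_lift (F : C(unitInterval × unitInterval, X))
    (hl : ∀ s, F (0, s) = F (1, s)) (hr : ∀ s, F (s, 0) = F (s, 1)) :
    ∃ f : C(Torus 2, X), f.comp squareToTorus = F := by
  refine ⟨isQuotientMap_squareToTorus.lift F ?_, isQuotientMap_squareToTorus.lift_comp F _⟩
  rintro ⟨s, t⟩ ⟨s', t'⟩ h
  have h0 := unitInterval_coe_eq_coe (congrFun h 0)
  have h1 := unitInterval_coe_eq_coe (congrFun h 1)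
  have e1 : F (s, t) = F (s', t) := by
    rcases h0 with rfl | ⟨rfl, rfl⟩ | ⟨rfl, rfl⟩
    exacts [rfl, hl t, (hl t).symm]
  have e2 : F (s', t) = F (s', t') := by
    rcases h1 with rfl | ⟨rfl, rfl⟩ | ⟨rfl, rfl⟩
    exacts [rfl, hr s', (hr s').symm]
  exact e1.trans e2

/-- The tautological path of loops in the torus. -/
def torusLoops : C(Simplex 1, LoopSpace (Torus 2)) where
  toFun x := ⟨(squareToTorus.curry) (height ![0, 1] x), squareToTorus_right _⟩
  continuous_toFun := by
    refine Continuous.subtype_mk ?_ _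
    exact squareToTorus.curry.continuous.comp (height ![0, 1]).continuous

theorem torusLoops_closed : torusLoops (vtx 0) = torusLoops (vtx 1) := by
  refine Subtype.ext (ContinuousMap.ext fun s => ?_)
  change squareToTorus (height ![0, 1] (vtx 0), s) = squareToTorus (height ![0, 1] (vtx 1), s)
  rw [height_vtx, height_vtx]
  exact squareToTorus_left s

/-- The adjoint of `σ` is a map on the square. It respects one identification of sides because `σ`
is closed and the other because its values are loops. -/
theorem exists_loopMap_torusLoops (σ : C(Simplex 1, LoopSpace X)) (hσ : σ (vtx 0) = σ (vtx 1)) :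
    ∃ f : C(Torus 2, X), (loopMap f).comp torusLoops = σ := by
  have hcont : Continuous fun p : unitInterval × unitInterval => (σ (unitPoint p.1)).1 p.2 := by
    fun_prop
  obtain ⟨f, hf⟩ := exists_torus_lift ⟨_, hcont⟩
    (fun s => by
      change (σ (unitPoint 0)).1 s = (σ (unitPoint 1)).1 s
      rw [unitPoint_zero, unitPoint_one, hσ])
    (fun s => (σ (unitPoint s)).2)
  refine ⟨f, ContinuousMap.ext fun x => Subtype.ext (ContinuousMap.ext fun s => ?_)⟩
  refine (DFunLike.congr_fun hf (height ![0, 1] x, s)).trans ?_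
  change (σ (unitPoint (height ![0, 1] x))).1 s = _
  rw [unitPoint_height]

theorem cohomologyClass_eq_zero_iff {c : cocycles X A n} :
    cohomologyClass n c = 0 ↔ (c : Cochain n X A) ∈ coboundaries X A n := by
  rw [cohomologyClass, QuotientAddGroup.mk'_apply, QuotientAddGroup.eq_zero_iff,
    AddSubgroup.mem_addSubgroupOf]

theorem cohomologyMap_class (f : C(X, Y)) (c : cocycles Y A n) :
    cohomologyMap n f (cohomologyClass n c) = cohomologyClass n (cocyclesMap n f c) := rfl

theorem cohomologyMap_class_eq_zero_iff (f : C(X, Y)) (c : cocycles Y A n) :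
    cohomologyMap n f (cohomologyClass n c) = 0 ↔
      cochainMap n f (c : Cochain n Y A) ∈ coboundaries X A n := by
  rw [cohomologyMap_class, cohomologyClass_eq_zero_iff]
  rfl

theorem loopCochain_mem_coboundaries (c : cocycles X A 2)
    (hc : IsAtoroidal (cohomologyClass 2 c)) :
    loopCochain (c : Cochain 2 X A) ∈ coboundaries (LoopSpace X) A 1 := by
  refine mem_coboundaries_one_of_closed (loopCochain_mem_cocycles c.2) fun σ hσ => ?_
  obtain ⟨f, rfl⟩ := exists_loopMap_torusLoops σ hσ
  obtain ⟨e, he⟩ := (cohomologyMap_class_eq_zero_iff f c).1 (hc f)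
  change cochainMap 1 (loopMap f) (loopCochain (c : Cochain 2 X A)) torusLoops = 0
  rw [cochainMap_loopMap, ← he, loopCochain_coboundary, coboundary_zero_apply,
    comp_simplexMap_vertex, comp_simplexMap_vertex, torusLoops_closed, sub_self]

end Loops

/-! ### Two-cocycles that vanish on small simplices -/

section Small

variable {A : Type v} [AddCommGroup A] {m n : ℕ}

/-- The point at time `t` of the segment from `p` to `q`. -/
def seg (p q : Simplex n) (t : unitInterval) : Simplex n :=
  ⟨AffineMap.lineMap (p : Fin (n + 1) → ℝ) (q : Fin (n + 1) → ℝ) (t : ℝ),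
    (convex_stdSimplex ℝ (Fin (n + 1))).lineMap_mem p.2 q.2 t.2⟩

theorem seg_apply (p q : Simplex n) (t : unitInterval) (i : Fin (n + 1)) :
    seg p q t i = t * (q i - p i) + p i := by
  change AffineMap.lineMap (p : Fin (n + 1) → ℝ) (q : Fin (n + 1) → ℝ) (t : ℝ) i = _
  rw [AffineMap.lineMap_apply]
  rfl

theorem seg_zero (p q : Simplex n) : seg p q 0 = p := by
  ext i
  simp [seg_apply]

theorem seg_one (p q : Simplex n) : seg p q 1 = q := by
  ext i
  simp [seg_apply]

theorem dist_seg_seg (p q : Simplex n) (s t : unitInterval) :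
    dist (seg p q s) (seg p q t) = dist s t * dist p q :=
  dist_lineMap_lineMap (p : Fin (n + 1) → ℝ) (q : Fin (n + 1) → ℝ) (s : ℝ) (t : ℝ)

theorem dist_seg_le (x p q : Simplex n) (t : unitInterval) :
    dist (seg x p t) (seg x q t) ≤ dist p q := by
  refine (dist_pi_le_iff dist_nonneg).2 fun i => ?_
  have h := dist_le_pi_dist (p : Fin (n + 1) → ℝ) (q : Fin (n + 1) → ℝ) i
  refine le_trans ?_ h
  change dist (seg x p t i) (seg x q t i) ≤ dist (p i) (q i)
  rw [seg_apply, seg_apply, Real.dist_eq, Real.dist_eq]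
  have : (t : ℝ) * (p i - x i) + x i - (t * (q i - x i) + x i) = t * (p i - q i) := by ring
  rw [this, abs_mul, abs_of_nonneg t.2.1]
  exact mul_le_of_le_one_left (abs_nonneg _) t.2.2

theorem dist_simplex_le_one (p q : Simplex n) : dist p q ≤ 1 := by
  refine (dist_pi_le_iff zero_le_one).2 fun i => ?_
  change dist (p i) (q i) ≤ 1
  rw [Real.dist_eq, abs_le]
  have := stdSimplex.zero_le p i
  have := stdSimplex.zero_le q i
  have := stdSimplex.le_one p i
  have := stdSimplex.le_one q i
  constructor <;> linarith

/-- The chains run along the segments from `x`. Their length `N` does not depend on the end point,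
and chains to nearby points stay close at every index. -/
theorem exists_chain (x : Simplex n) {ε : ℝ} (hε : 0 < ε) :
    ∃ (N : ℕ) (y : Simplex n → ℕ → Simplex n), (∀ p, y p 0 = x) ∧ (∀ p, y p N = p) ∧
      (∀ p i, dist (y p i) (y p (i + 1)) < ε) ∧ ∀ p q i, dist (y p i) (y q i) ≤ dist p q := by
  obtain ⟨N, hN⟩ := exists_nat_one_div_lt hε
  have hN0 : (0 : ℝ) < N + 1 := by positivity
  refine ⟨N + 1, fun p i => seg x p (Set.projIcc 0 1 zero_le_one ((i : ℝ) / (N + 1))),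
    fun p => ?_, fun p => ?_, fun p i => ?_, fun p q i => dist_seg_le _ _ _ _⟩
  · have : Set.projIcc (0 : ℝ) 1 zero_le_one (((0 : ℕ) : ℝ) / (N + 1)) = 0 := by simp
    exact (congrArg _ this).trans (seg_zero x p)
  · have : Set.projIcc (0 : ℝ) 1 zero_le_one (((N + 1 : ℕ) : ℝ) / (N + 1)) = 1 := by
      push_cast
      rw [div_self hN0.ne']
      simp
    exact (congrArg _ this).trans (seg_one x p)
  · rw [dist_seg_seg]
    refine (mul_le_of_le_one_right dist_nonneg (dist_simplex_le_one x p)).trans_lt ?_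
    refine lt_of_le_of_lt ?_ hN
    refine (Set.abs_projIcc_sub_projIcc zero_le_one).trans_eq ?_
    have : (i : ℝ) / (N + 1) - ((i + 1 : ℕ) : ℝ) / (N + 1) = -(1 / (N + 1)) := by
      push_cast; ring
    rw [this, abs_neg, abs_of_pos (by positivity)]

/-- The primitive is the sum of `w` along the chain to the point. The chains to two nearby points
bound a ladder, each square of which is cut into two small triangles where the local cocycle
condition applies; half of `ε` keeps the diagonals short enough. -/
theorem exists_local_primitive (w : Simplex n → Simplex n → A) {ε : ℝ} (hε : 0 < ε)
    (hw : ∀ p q r, dist p q < ε → dist p r < ε → w q r - w p r + w p q = 0) :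
    ∃ h : Simplex n → A, ∃ ε' > 0, ∀ p q, dist p q < ε' → w p q = h q - h p := by
  obtain ⟨N, y, h0, h1, hs, hd⟩ := exists_chain (vtx 0 : Simplex n) (half_pos hε)
  refine ⟨fun p => ∑ i ∈ Finset.range N, w (y p i) (y p (i + 1)), ε / 2, half_pos hε,
    fun p q hpq => ?_⟩
  have key : ∀ k, w (y p k) (y q k) = ∑ i ∈ Finset.range k, w (y q i) (y q (i + 1)) -
      ∑ i ∈ Finset.range k, w (y p i) (y p (i + 1)) := by
    intro k
    induction k with
    | zero =>
      -- The degenerate triangle forces `w` to vanish on the diagonal at the starting point.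
      have h := hw (vtx 0) (vtx 0) (vtx 0) (by simpa using hε) (by simpa using hε)
      simpa [h0] using h
    | succ k ih =>
      have hk := (hd p q k).trans_lt hpq
      have hk1 := (hd p q (k + 1)).trans_lt hpq
      have hk2 : dist (y p k) (y q (k + 1)) < ε := by
        have := dist_triangle (y p k) (y q k) (y q (k + 1))
        have := hs q k
        linarith
      have e1 := hw (y p k) (y q k) (y q (k + 1)) (by linarith) hk2
      have e2 := hw (y p k) (y p (k + 1)) (y q (k + 1)) (by linarith [hs p k]) hk2
      rw [Finset.sum_range_succ, Finset.sum_range_succ, add_sub_add_comm, ← ih]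
      rw [← sub_eq_zero, ← sub_eq_zero.2 (e2.trans e1.symm)]
      abel
  have := key N
  rwa [h1, h1] at this

/-- Coning off to the vertex `vtx 0` gives the primitive `Z (vtx 0)`. Near the diagonal it is a
local cocycle, so subtracting the coboundary of a local primitive makes it vanish there without
changing its own coboundary. -/
theorem exists_small_primitive (Z : Simplex n → Simplex n → Simplex n → A)
    (hZ : ∀ p q r s, Z q r s - Z p r s + Z p q s - Z p q r = 0) {ε : ℝ} (hε : 0 < ε)
    (hs : ∀ p q r, dist p q < ε → dist p r < ε → Z p q r = 0) :
    ∃ w : Simplex n → Simplex n → A, (∀ p q r, Z p q r = w q r - w p r + w p q) ∧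
      ∃ ε' > 0, ∀ p q, dist p q < ε' → w p q = 0 := by
  have hw (p q r) : Z p q r = Z (vtx 0) q r - Z (vtx 0) p r + Z (vtx 0) p q := by
    rw [← sub_eq_zero, ← hZ (vtx 0) p q r]
    abel
  obtain ⟨h, ε', hε', hh⟩ := exists_local_primitive (Z (vtx 0)) hε fun p q r h1 h2 => by
    rw [← hw]; exact hs p q r h1 h2
  refine ⟨fun p q => Z (vtx 0) p q - (h q - h p), fun p q r => ?_, ε', hε', fun p q hpq => ?_⟩
  · rw [hw]
    beta_reduce
    abel
  · beta_reduce
    rw [hh p q hpq, sub_self]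

/-- A cocycle is additive along a chain with short steps. This gives the uniqueness of small
primitives. -/
theorem eq_zero_of_small (d : Simplex n → Simplex n → A)
    (hd : ∀ p q r, d q r - d p r + d p q = 0) {ε : ℝ} (hε : 0 < ε)
    (hs : ∀ p q, dist p q < ε → d p q = 0) (p q : Simplex n) : d p q = 0 := by
  obtain ⟨N, y, h0, h1, hy, -⟩ := exists_chain p hε
  have key : ∀ k, d p (y q k) = 0 := by
    intro k
    induction k with
    | zero => exact hs _ _ (by simpa [h0] using hε)
    | succ k ih =>
      have h := hd p (y q k) (y q (k + 1))
      rwa [ih, hs _ _ (hy q k), zero_sub, add_zero, neg_eq_zero] at h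
  rw [← h1 q]
  exact key N

theorem affineSimplex_mem_ball {p : Fin (m + 1) → Simplex n} {x : Simplex n} {ε : ℝ}
    (h : ∀ i, p i ∈ Metric.ball x ε) (t : Simplex m) : affineSimplex p t ∈ Metric.ball x ε := by
  have hc := (convex_ball (x : Fin (n + 1) → ℝ) ε).sum_mem (t := Finset.univ) (w := fun i => t i)
    (z := fun i => (p i : Fin (n + 1) → ℝ)) (fun i _ => stdSimplex.zero_le t i)
    (stdSimplex.sum_eq_one t) (fun i _ => h i)
  have e : ((affineSimplex p t : Simplex n) : Fin (n + 1) → ℝ) =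
      ∑ i, t i • (p i : Fin (n + 1) → ℝ) := by
    funext j
    rw [Finset.sum_apply]
    rfl
  change dist ((affineSimplex p t : Simplex n) : Fin (n + 1) → ℝ) x < ε
  rw [e]
  exact hc

variable {Y : Type w} [TopologicalSpace Y] {ι : Type*} {U : ι → Set Y}

/-- On each singular simplex, `z` restricted to affine triangles has a primitive that vanishes on
short segments. Its uniqueness makes these primitives compatible with faces, so their values on
edges define a cochain on `Y`. -/
theorem mem_coboundaries_two_of_small (hU : ∀ i, IsOpen (U i)) (hcov : ⋃ i, U i = univ)
    {z : Cochain 2 Y A} (hz : z ∈ cocycles Y A 2)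
    (hs : ∀ (i : ι) (σ : C(Simplex 2, Y)), range σ ⊆ U i → z σ = 0) :
    z ∈ coboundaries Y A 2 := by
  have hex (n : ℕ) (σ : C(Simplex n, Y)) : ∃ w : Simplex n → Simplex n → A,
      (∀ p q r, z (σ.comp (affineSimplex ![p, q, r])) = w q r - w p r + w p q) ∧
        ∃ ε' > 0, ∀ p q, dist p q < ε' → w p q = 0 := by
    -- Balls are convex, so below the Lebesgue number an affine triangle is mapped into a single `U
    -- i`.
    obtain ⟨ε, hε, hball⟩ := lebesgue_number_lemma_of_metric (s := (univ : Set (Simplex n)))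
      (c := fun i => σ ⁻¹' U i) isCompact_univ (fun i => (hU i).preimage σ.continuous)
      (by rw [← preimage_iUnion, hcov, preimage_univ])
    refine exists_small_primitive (fun p q r => z (σ.comp (affineSimplex ![p, q, r])))
      (fun p q r s => ?_) hε fun p q r hpq hpr => ?_
    · have h := congrFun (show coboundary 2 z = 0 from hz) (σ.comp (affineSimplex ![p, q, r, s]))
      rw [coboundary_two_apply] at h
      simp only [ContinuousMap.comp_assoc, affineSimplex_simplexMap] at h
      change _ = (0 : A) at h
      convert h using 7 <;>
      · funext i; fin_cases i <;> rfl
    · obtain ⟨i, hi⟩ := hball p (mem_univ _)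
      refine hs i _ ?_
      rintro _ ⟨t, rfl⟩
      refine hi (affineSimplex_mem_ball (fun j => ?_) t)
      fin_cases j
      · exact Metric.mem_ball_self hε
      · exact (dist_comm _ _).trans_lt hpq
      · exact (dist_comm _ _).trans_lt hpr
  choose w hw hwε using hex
  have hnat {m n : ℕ} (σ : C(Simplex n, Y)) (g : Fin (m + 1) → Fin (n + 1)) (p q : Simplex m) :
      w m (σ.comp (simplexMap g)) p q = w n σ (simplexMap g p) (simplexMap g q) := by
    obtain ⟨ε₁, hε₁, h₁⟩ := hwε m (σ.comp (simplexMap g))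
    obtain ⟨ε₂, hε₂, h₂⟩ := hwε n σ
    obtain ⟨ε₃, hε₃, h₃⟩ := Metric.uniformContinuous_iff.1
      (CompactSpace.uniformContinuous_of_continuous (simplexMap g).continuous) ε₂ hε₂
    rw [← sub_eq_zero]
    refine eq_zero_of_small (fun p q => w m (σ.comp (simplexMap g)) p q -
      w n σ (simplexMap g p) (simplexMap g q)) (fun p q r => ?_) (lt_min hε₁ hε₃)
      (fun p q hpq => ?_) p q
    · have e₁ := hw m (σ.comp (simplexMap g)) p q r
      have e₂ := hw n σ (simplexMap g p) (simplexMap g q) (simplexMap g r)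
      have e : (σ.comp (simplexMap g)).comp (affineSimplex ![p, q, r]) =
          σ.comp (affineSimplex ![simplexMap g p, simplexMap g q, simplexMap g r]) := by
        rw [ContinuousMap.comp_assoc, simplexMap_affineSimplex]
        congr 2
        funext i
        fin_cases i <;> rfl
      rw [e, e₂] at e₁
      rw [← sub_eq_zero.2 e₁.symm]
      abel
    · rw [h₁ p q (hpq.trans_le (min_le_left _ _)), h₂ _ _ (h₃ (hpq.trans_le (min_le_right _ _))),
        sub_self]
  refine ⟨fun τ => w 1 τ (vtx 0) (vtx 1), funext fun σ => ?_⟩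
  have h := hw 2 σ (vtx 0) (vtx 1) (vtx 2)
  have e : affineSimplex ![vtx 0, vtx 1, vtx 2] = .id (Simplex 2) := by
    rw [← affineSimplex_vtx]
    congr 1
    funext i
    fin_cases i <;> rfl
  rw [e, ContinuousMap.comp_id] at h
  rw [coboundary_one_apply, h]
  simp only [hnat, simplexMap_vtx]
  rfl

end Small

/-! ### Vanishing on covers by two sets -/

section TwoSets

variable {X : Type u} [TopologicalSpace X] {Y : Type w} [TopologicalSpace Y]
  {A : Type v} [AddCommGroup A] {n : ℕ}

theorem comp_vec_one {α : Type*} (v : Fin n → α) (i : Fin n) : v ∘ ![i] = ![v i] := by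
  funext k; fin_cases k; rfl

theorem comp_vec_two {α : Type*} (v : Fin n → α) (i j : Fin n) : v ∘ ![i, j] = ![v i, v j] := by
  funext k; fin_cases k <;> rfl

theorem coboundary_coboundary_one (e : Cochain 1 Y A) :
    coboundary 2 (coboundary 1 e) = 0 := by
  funext σ
  simp [coboundary_two_apply, coboundary_one_apply, ContinuousMap.comp_assoc, simplexMap_comp,
    comp_vec_two]
  abel

theorem coboundary_coboundary_zero (g : Cochain 0 Y A) :
    coboundary 1 (coboundary 0 g) = 0 := by
  funext σ
  simp [coboundary_one_apply, coboundary_zero_apply, ContinuousMap.comp_assoc, simplexMap_comp,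
    comp_vec_one]

/-- The free loop space is the pullback of the path fibration with itself. -/
theorem exists_loop_lift (p q : C(Y, PathSpace X)) (h : ∀ y, endpoints (p y) = endpoints (q y)) :
    ∃ l : C(Y, LoopSpace X), r₁.comp l = p ∧ r₂.comp l = q := by
  have h0 (y : Y) : p y 0 = q y 0 := congrArg Prod.fst (h y)
  have h1 (y : Y) : p y 1 = q y 1 := congrArg Prod.snd (h y)
  let P (y : Y) : Path (p y 0) (p y 1) := ⟨p y, rfl, rfl⟩
  let Q (y : Y) : Path (p y 1) (p y 0) :=
    ⟨(q y).comp ⟨unitInterval.symm, unitInterval.continuous_symm⟩,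
      by simp [h1], by simp [h0]⟩
  have hP : Continuous ↿P := by
    change Continuous fun z : Y × unitInterval => p z.1 z.2
    fun_prop
  have hQ : Continuous ↿Q := by
    change Continuous fun z : Y × unitInterval => q z.1 (unitInterval.symm z.2)
    fun_prop
  have hT := Path.trans_continuous_family P hP Q hQ
  refine ⟨⟨fun y => ⟨((P y).trans (Q y)).toContinuousMap,
    ((P y).trans (Q y)).source.trans ((P y).trans (Q y)).target.symm⟩,
    Continuous.subtype_mk (ContinuousMap.curry ⟨_, hT⟩).continuous _⟩, ?_, ?_⟩
  · ext y t
    have ht := t.2.2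
    change ((P y).trans (Q y)) (psi₁ t) = p y t
    have hv : (psi₁ t : ℝ) = t / 2 := rfl
    rw [Path.trans_apply, dif_pos (by rw [hv]; linarith)]
    change p y _ = _
    congr 1
    ext
    change 2 * (psi₁ t : ℝ) = t
    rw [hv]; ring
  · ext y t
    have ht := t.2.2
    change ((P y).trans (Q y)) (psi₂ t) = q y t
    have hv : (psi₂ t : ℝ) = 1 - t / 2 := rfl
    rw [Path.trans_apply]
    split_ifs with hle
    -- The reversed second half meets the first one only at the midpoint of the loop, where `p` and
    -- `q` end together.
    · have ht1 : t = 1 := by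
        ext
        change (t : ℝ) = 1
        linarith
      subst ht1
      rw [← h1 y]
      change p y _ = p y 1
      congr 1
      ext
      change 2 * (psi₂ 1 : ℝ) = 1
      rw [hv]; norm_num
    · change q y _ = q y t
      congr 1
      ext
      change 1 - (2 * (psi₂ t : ℝ) - 1) = t
      rw [hv]; ring

/-- A singular simplex with values in a subset, as a singular simplex of the subset. -/
def restrictSimplex (τ : C(Simplex n, Y)) {S : Set Y} (h : ∀ x, τ x ∈ S) : C(Simplex n, S) :=
  ⟨fun x => ⟨τ x, h x⟩, τ.continuous.subtype_mk _⟩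

open Classical in
theorem vanishesOnCovers_two (c : cocycles X A 2)
    (hc : loopCochain (c : Cochain 2 X A) ∈ coboundaries (LoopSpace X) A 1) :
    VanishesOnCovers (cohomologyClass 2 (zeroDivisor c)) 2 := by
  intro Y _ f U hU hcov hs
  choose s hs using hs
  obtain ⟨g, hg⟩ := hc
  set b := transfer 1 (c : Cochain 2 X A) with hb
  obtain ⟨l, hl₁, hl₂⟩ := exists_loop_lift (Y := ↥(U 0 ∩ U 1))
    ((s 0).comp (.inclusion inter_subset_left)) ((s 1).comp (.inclusion inter_subset_right))
    fun y => (hs 0 (inclusion inter_subset_left y)).trans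
      (hs 1 (inclusion inter_subset_right y)).symm
  -- Cochains are arbitrary functions on simplices, so the pullback of `g` extends by zero.
  let g' : Cochain 0 Y A := fun ρ =>
    if h : ∀ x, ρ x ∈ U 0 ∩ U 1 then g (l.comp (restrictSimplex ρ h)) else 0
  let β : Cochain 1 Y A := fun τ =>
    if h : ∀ x, τ x ∈ U 0 then b ((s 0).comp (restrictSimplex τ h))
    else if h : ∀ x, τ x ∈ U 1 then b ((s 1).comp (restrictSimplex τ h)) + coboundary 0 g' τ
    else 0
  -- The two formulas for `β` agree on simplices in the intersection, because there the difference
  -- of the two primitives is the pullback of `δ g`.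
  have hβ₀ (τ) (h : ∀ x, τ x ∈ U 0) : β τ = b ((s 0).comp (restrictSimplex τ h)) := dif_pos h
  have hβ₁ (τ) (h : ∀ x, τ x ∈ U 1) :
      β τ = b ((s 1).comp (restrictSimplex τ h)) + coboundary 0 g' τ := by
    by_cases h0 : ∀ x, τ x ∈ U 0
    · rw [hβ₀ τ h0]
      have h01 : ∀ x, τ x ∈ U 0 ∩ U 1 := fun x => ⟨h0 x, h x⟩
      have e := congrFun hg (l.comp (restrictSimplex τ h01))
      have e1 : loopCochain (c : Cochain 2 X A) (l.comp (restrictSimplex τ h01)) =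
          b ((r₁.comp l).comp (restrictSimplex τ h01)) -
            b ((r₂.comp l).comp (restrictSimplex τ h01)) := rfl
      have e2 : coboundary 0 g' τ = coboundary 0 g (l.comp (restrictSimplex τ h01)) := by
        rw [coboundary_zero_apply, coboundary_zero_apply]
        have (i : Fin 1 → Fin 2) : g' (τ.comp (simplexMap i)) =
            g ((l.comp (restrictSimplex τ h01)).comp (simplexMap i)) :=
          dif_pos (fun x => h01 _)
        rw [this, this]
      rw [e2, e, e1, hl₁, hl₂]
      exact (add_sub_cancel _ _).symm
    · exact (dif_neg h0).trans (dif_pos h)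
  have hδ (i : Fin 2) (σ : C(Simplex 2, Y)) (h : ∀ x, σ x ∈ U i) :
      coboundary 1 b ((s i).comp (restrictSimplex σ h)) =
        cochainMap 2 f (zeroDivisor c : Cochain 2 (X × X) A) σ := by
    have e1 : (evalAt 1).comp ((s i).comp (restrictSimplex σ h)) =
        ContinuousMap.snd.comp (f.comp σ) :=
      ContinuousMap.ext fun x => congrArg Prod.snd (hs i ⟨σ x, h x⟩)
    have e0 : (evalAt 0).comp ((s i).comp (restrictSimplex σ h)) =
        ContinuousMap.fst.comp (f.comp σ) :=
      ContinuousMap.ext fun x => congrArg Prod.fst (hs i ⟨σ x, h x⟩)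
    rw [hb, coboundary_transfer_two _ c.2]
    change (c : Cochain 2 X A) _ - (c : Cochain 2 X A) _ = _
    rw [e1, e0]
    rfl
  rw [cohomologyMap_class_eq_zero_iff]
  have hz : cochainMap 2 f (zeroDivisor c : Cochain 2 (X × X) A) - coboundary 1 β ∈
      coboundaries Y A 2 := by
    refine mem_coboundaries_two_of_small hU hcov ?_ fun i σ hσ => ?_
    · refine sub_mem (cochainMap_mem_cocycles 2 f (zeroDivisor c).2) ?_
      exact coboundary_coboundary_one β
    · have hσ' : ∀ x, σ x ∈ U i := fun x => hσ (mem_range_self x)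
      rw [Pi.sub_apply, ← hδ i σ hσ', sub_eq_zero, coboundary_one_apply]
      have hface (j : Fin 2 → Fin 3) : ∀ x, σ.comp (simplexMap j) x ∈ U i := fun x => hσ' _
      obtain rfl | rfl : i = 0 ∨ i = 1 := by omega
      · rw [coboundary_one_apply, hβ₀ _ (hface _), hβ₀ _ (hface _), hβ₀ _ (hface _)]
        rfl
      · have hgg := congrFun (coboundary_coboundary_zero g') σ
        rw [coboundary_one_apply] at hgg
        rw [coboundary_one_apply, hβ₁ _ (hface _), hβ₁ _ (hface _), hβ₁ _ (hface _)]
        rw [add_sub_add_comm, add_add_add_comm, hgg]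
        exact (add_zero _).symm
  have := add_mem hz (show coboundary 1 β ∈ coboundaries Y A 2 from ⟨β, rfl⟩)
  rwa [sub_add_cancel] at this

/-! ### The fiberwise join -/

variable (X) in
/-- The quotient map onto the fiberwise join. -/
def joinMk (p : PreJoin X) : FiberwiseJoin X := Quot.mk _ p

theorem isQuotientMap_joinMk : IsQuotientMap (joinMk X) := isQuotientMap_quot_mk

open Classical in
/-- The section of `π₂` that is `r₁` on the part of the cylinder where `P` holds and `r₂` on the
rest. -/
def joinSection (P : ℝ → Prop) (h₁ : P 1) (h₂ : ¬ P 2) : FiberwiseJoin X → PathSpace X :=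
  Quot.lift (Sum.elim (fun p => if P p.2 then r₁ p.1 else r₂ p.1) (Sum.elim id id)) <| by
    rintro _ _ (γ | γ)
    · exact if_pos h₁
    · exact if_neg h₂

theorem endpoints_joinSection (P : ℝ → Prop) (h₁ : P 1) (h₂ : ¬ P 2) (y : FiberwiseJoin X) :
    endpoints (joinSection P h₁ h₂ y) = joinProj X y := by
  have e (γ : LoopSpace X) (t) : endpoints (r₁ γ) = preEndpoints X (.inl (γ, t)) :=
    (preEndpoints_eq_of_joinRel _ _ (JoinRel.left γ)).symm
  obtain ⟨p, rfl⟩ := Quot.exists_rep y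
  rcases p with ⟨γ, t⟩ | γ | γ
  · by_cases h : P t
    · exact (congrArg endpoints (if_pos h)).trans (e γ t)
    · exact (congrArg endpoints (if_neg h)).trans
        ((endpoints_r₁_eq_endpoints_r₂ γ).symm.trans (e γ t))
  · rfl
  · rfl

/-- The part of the fiberwise join given by a predicate `Q` on the cylinder, and the predicates
`Q₁`, `Q₂` on the two ends. -/
def joinPart (Q : ℝ → Prop) (Q₁ Q₂ : Prop) (h₁ : Q 1 = Q₁) (h₂ : Q 2 = Q₂) :
    Set (FiberwiseJoin X) :=
  Set.ofPred <| Quot.lift (Sum.elim (fun p => Q p.2) (Sum.elim (fun _ => Q₁) fun _ => Q₂)) <| by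
    rintro _ _ (γ | γ)
    · exact h₁
    · exact h₂

theorem isOpen_joinPart {Q : ℝ → Prop} {Q₁ Q₂ : Prop} (h₁ : Q 1 = Q₁) (h₂ : Q 2 = Q₂)
    (hQ : IsOpen {t | Q t}) : IsOpen (joinPart (X := X) Q Q₁ Q₂ h₁ h₂) := by
  rw [← isQuotientMap_joinMk.isOpen_preimage, isOpen_sum_iff, isOpen_sum_iff]
  refine ⟨?_, ?_, ?_⟩
  · exact hQ.preimage (continuous_subtype_val.comp continuous_snd)
  · exact isOpen_const
  · exact isOpen_const

/-- Over an open part, continuity may be checked before passing to the quotient. There `P` is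
constant on the cylinder points concerned, so only one of `r₁`, `r₂` occurs. -/
theorem continuousOn_joinSection {Q : ℝ → Prop} {Q₁ Q₂ : Prop} (h₁ : Q 1 = Q₁) (h₂ : Q 2 = Q₂)
    (hQ : IsOpen {t | Q t}) {P : ℝ → Prop} (hP₁ : P 1) (hP₂ : ¬ P 2)
    (hPQ : (∀ t ∈ Icc (1 : ℝ) 2, Q t → P t) ∨ ∀ t ∈ Icc (1 : ℝ) 2, Q t → ¬ P t) :
    ContinuousOn (joinSection (X := X) P hP₁ hP₂) (joinPart Q Q₁ Q₂ h₁ h₂) := by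
  have hopen := isOpen_joinPart (X := X) h₁ h₂ hQ
  rw [isQuotientMap_joinMk.continuousOn_isOpen_iff hopen]
  intro x hx
  refine ContinuousAt.continuousWithinAt ?_
  rcases x with ⟨γ, t⟩ | γ | γ
  · rw [IsOpenEmbedding.inl.continuousAt_iff.symm]
    have hQ' : ∀ᶠ p : LoopSpace X × Icc (1 : ℝ) 2 in 𝓝 (γ, t), Q p.2 :=
      (hQ.preimage (continuous_subtype_val.comp continuous_snd)).mem_nhds hx
    rcases hPQ with h | h
    · refine (r₁.continuous.comp continuous_fst).continuousAt.congr ?_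
      filter_upwards [hQ'] with p hp
      exact (if_pos (h _ p.2.2 hp)).symm
    · refine (r₂.continuous.comp continuous_fst).continuousAt.congr ?_
      filter_upwards [hQ'] with p hp
      exact (if_neg (h _ p.2.2 hp)).symm
  · rw [← IsOpenEmbedding.inr.continuousAt_iff, ← IsOpenEmbedding.inl.continuousAt_iff]
    exact continuous_id.continuousAt
  · rw [← IsOpenEmbedding.inr.continuousAt_iff, ← IsOpenEmbedding.inr.continuousAt_iff]
    exact continuous_id.continuousAt

theorem cohomologyMap_joinProj_eq_zero {u : Cohomology (X × X) A n} (hu : VanishesOnCovers u 2) :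
    cohomologyMap n (joinProj X) u = 0 := by
  have hl₁ : ((1 : ℝ) < 2) = True := by simp
  have hl₂ : ((2 : ℝ) < 2) = False := by simp
  have hg₁ : ((1 : ℝ) < 1) = False := by simp
  have hg₂ : ((1 : ℝ) < 2) = True := by simp
  refine hu (FiberwiseJoin X) (joinProj X)
    ![joinPart (· < 2) True False hl₁ hl₂, joinPart (1 < ·) False True hg₁ hg₂] ?_ ?_ ?_
  · intro i
    fin_cases i
    · exact isOpen_joinPart (Q := (· < 2)) hl₁ hl₂ isOpen_Iio
    · exact isOpen_joinPart (Q := (1 < ·)) hg₁ hg₂ isOpen_Ioi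
  · refine eq_univ_of_forall fun y => mem_iUnion.2 ?_
    obtain ⟨p, rfl⟩ := Quot.exists_rep y
    rcases p with ⟨γ, t⟩ | γ | γ
    · rcases lt_or_ge (t : ℝ) 2 with h | h
      · exact ⟨0, h⟩
      · exact ⟨1, show (1 : ℝ) < t by linarith⟩
    · exact ⟨0, trivial⟩
    · exact ⟨1, trivial⟩
  · intro i
    fin_cases i
    -- The predicate must hold at `1` and fail at `2` to respect the gluing. Here it holds on the
    -- whole part, giving `r₁`; for the other set `· ≤ 1` fails on the whole part, giving `r₂`.
    · refine ⟨⟨_, (continuousOn_joinSection (Q := (· < 2)) hl₁ hl₂ isOpen_Iio (P := (· < 2)) (by norm_num)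
        (by norm_num) (.inl fun _ _ => id)).domRestrict⟩, fun y => ?_⟩
      exact endpoints_joinSection (· < 2) (by norm_num) (by norm_num) y.1
    · refine ⟨⟨_, (continuousOn_joinSection (Q := (1 < ·)) hg₁ hg₂ isOpen_Ioi (P := (· ≤ 1)) (by norm_num)
        (by norm_num) (.inr fun _ _ => not_le.2)).domRestrict⟩, fun y => ?_⟩
      exact endpoints_joinSection (· ≤ 1) (by norm_num) (by norm_num) y.1

end TwoSets

/-! ### Stars in the barycentric subdivision of a simplex -/

section Stars

variable {n k : ℕ}

/-- The open star of the barycenter of the face spanned by `B` in the barycentric subdivision. -/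
def openStar (B : Finset (Fin (n + 1))) : Set (Simplex n) :=
  {t | ∀ i ∈ B, 0 < t i ∧ ∀ j ∉ B, t j < t i}

theorem isOpen_openStar (B : Finset (Fin (n + 1))) : IsOpen (openStar B) := by
  have : openStar B = ⋂ i ∈ B, ({t : Simplex n | 0 < t i} ∩ ⋂ j ∈ Bᶜ, {t : Simplex n | t j < t i}) := by
    ext t
    simp [openStar]
  rw [this]
  refine isOpen_biInter_finset fun i _ => ?_
  exact (isOpen_lt continuous_const (continuous_coord i)).inter
    (isOpen_biInter_finset fun j _ => isOpen_lt (continuous_coord j) (continuous_coord i))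

/-- A point in the star of `B` has its `B.card` largest coordinates exactly at `B`. Thus stars of
faces of equal dimension are disjoint. -/
theorem openStar_unique {B C : Finset (Fin (n + 1))} {t : Simplex n} (hB : t ∈ openStar B)
    (hC : t ∈ openStar C) (h : B.card = C.card) : B = C := by
  by_contra hne
  have h1 : ¬ B ⊆ C := fun hs => hne (Finset.eq_of_subset_of_card_le hs h.ge)
  have h2 : ¬ C ⊆ B := fun hs => hne (Finset.eq_of_subset_of_card_le hs h.le).symm
  obtain ⟨i, hi, hi'⟩ := Finset.not_subset.1 h1
  obtain ⟨j, hj, hj'⟩ := Finset.not_subset.1 h2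
  exact lt_asymm ((hB i hi).2 j hj') ((hC j hj).2 i hi')

/-- The point `t` lies in the open star of the barycenter of a `k`-dimensional face whose least
vertex is `i`. -/
def IsStarIndex (k : ℕ) (t : Simplex n) (i : Fin (n + 1)) : Prop :=
  ∃ B : Finset (Fin (n + 1)), B.card = k + 1 ∧ t ∈ openStar B ∧ IsLeast (B : Set (Fin (n + 1))) i

theorem IsStarIndex.unique {t : Simplex n} {i j : Fin (n + 1)} (hi : IsStarIndex k t i)
    (hj : IsStarIndex k t j) : i = j := by
  obtain ⟨B, hB, htB, hBi⟩ := hi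
  obtain ⟨C, hC, htC, hCj⟩ := hj
  obtain rfl := openStar_unique htB htC (hB.trans hC.symm)
  exact hBi.unique hCj

theorem isOpen_isStarIndex (i : Fin (n + 1)) : IsOpen {t : Simplex n | IsStarIndex k t i} := by
  have : {t : Simplex n | IsStarIndex k t i} =
      ⋃ B : {B : Finset (Fin (n + 1)) // B.card = k + 1 ∧ IsLeast (B : Set (Fin (n + 1))) i},
        openStar B.1 := by
    ext t
    simp only [IsStarIndex, mem_ofPred_eq, mem_iUnion, Subtype.exists]
    exact ⟨fun ⟨B, h1, h2, h3⟩ => ⟨B, ⟨h1, h3⟩, h2⟩, fun ⟨B, ⟨h1, h3⟩, h2⟩ => ⟨B, h1, h2, h3⟩⟩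
  rw [this]
  exact isOpen_iUnion fun B => isOpen_openStar _

theorem exists_isStarIndex (t : Simplex n) : ∃ k ≤ n, ∃ i, IsStarIndex k t i := by
  obtain ⟨m, -, hm⟩ := Finset.exists_max_image Finset.univ (fun i => t i) Finset.univ_nonempty
  have hpos : 0 < t m := by
    by_contra h
    have h0 : ∀ i, t i = 0 := fun i =>
      le_antisymm ((hm i (Finset.mem_univ i)).trans (not_lt.1 h)) (stdSimplex.zero_le t i)
    have := stdSimplex.sum_eq_one t
    simp [h0] at this
  -- The set of maximal coordinates of `t` is a face whose star contains `t`.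
  set B := Finset.univ.filter fun i => t i = t m with hB
  have hmB : m ∈ B := by simp [hB]
  have hne : B.Nonempty := ⟨m, hmB⟩
  have hcard : B.card ≤ n + 1 := (Finset.card_le_univ B).trans_eq (Fintype.card_fin _)
  refine ⟨B.card - 1, by omega, B.min' hne, B, ?_, fun i hi => ?_, B.isLeast_min' hne⟩
  · have := hne.card_pos
    omega
  · have hi' : t i = t m := by simpa [hB] using hi
    refine ⟨hi' ▸ hpos, fun j hj => ?_⟩
    rw [hi']
    refine lt_of_le_of_ne (hm j (Finset.mem_univ j)) ?_
    simpa [hB] using hj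

theorem face_apply_self (a : Fin (n + 2)) (t : Simplex n) : face a t a = 0 := by
  have h := sum_simplexMap a.succAbove t (Pi.single a 1)
  change ∑ j, face a t j * _ = _ at h
  simpa [Pi.single_apply, Fin.succAbove_ne] using h

theorem face_apply_succAbove (a : Fin (n + 2)) (t : Simplex n) (i : Fin (n + 1)) :
    face a t (a.succAbove i) = t i := by
  have h := sum_simplexMap a.succAbove t (Pi.single (a.succAbove i) 1)
  change ∑ j, face a t j * _ = _ at h
  simpa [Pi.single_apply, Fin.succAbove_right_inj] using h

/-- The only new coordinate is zero, and the coordinates of a star point at `B` are positive, so the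
extra inequality is automatic. -/
theorem face_mem_openStar_iff (a : Fin (n + 2)) (t : Simplex n) (B : Finset (Fin (n + 1))) :
    face a t ∈ openStar (B.map a.succAboveEmb) ↔ t ∈ openStar B := by
  constructor
  · intro h i hi
    obtain ⟨h1, h2⟩ := h (a.succAbove i) (Finset.mem_map_of_mem a.succAboveEmb hi)
    rw [face_apply_succAbove] at h1 h2
    refine ⟨h1, fun j hj => ?_⟩
    have := h2 (a.succAbove j) (by
      rw [← Fin.coe_succAboveEmb, Finset.mem_map']
      exact hj)
    rwa [face_apply_succAbove] at this
  · intro h i' hi'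
    obtain ⟨i, hi, rfl⟩ := Finset.mem_map.1 hi'
    rw [Fin.coe_succAboveEmb, face_apply_succAbove]
    refine ⟨(h i hi).1, fun j' hj' => ?_⟩
    rcases Fin.eq_self_or_eq_succAbove a j' with rfl | ⟨j, rfl⟩
    · rw [face_apply_self]
      exact (h i hi).1
    · rw [face_apply_succAbove]
      refine (h i hi).2 j fun hj => hj' ?_
      exact Finset.mem_map_of_mem a.succAboveEmb hj

theorem isLeast_map_succAbove (a : Fin (n + 2)) {B : Finset (Fin (n + 1))} {i : Fin (n + 1)}
    (h : IsLeast (B : Set (Fin (n + 1))) i) :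
    IsLeast (B.map a.succAboveEmb : Set (Fin (n + 2))) (a.succAbove i) := by
  rw [Finset.coe_map]
  exact (Fin.strictMono_succAbove a).monotone.map_isLeast h

theorem IsStarIndex.face {t : Simplex n} {i : Fin (n + 1)} (h : IsStarIndex k t i)
    (a : Fin (n + 2)) : IsStarIndex k (face a t) (a.succAbove i) := by
  obtain ⟨B, hB, ht, hi⟩ := h
  exact ⟨B.map a.succAboveEmb, (Finset.card_map _).trans hB, (face_mem_openStar_iff a t B).2 ht,
    isLeast_map_succAbove a hi⟩

theorem IsStarIndex.of_face {t : Simplex n} {a : Fin (n + 2)} {j : Fin (n + 2)}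
    (h : IsStarIndex k (TCWeight.face a t) j) : ∃ i, IsStarIndex k t i := by
  obtain ⟨C, hC, ht, hj⟩ := h
  have ha : a ∉ C := fun ha => by
    have := (ht a ha).1
    rw [face_apply_self] at this
    exact lt_irrefl _ this
  obtain ⟨B, rfl⟩ : ∃ B : Finset (Fin (n + 1)), C = B.map a.succAboveEmb := by
    refine ⟨Finset.univ.filter fun i => a.succAbove i ∈ C, ?_⟩
    ext j
    rcases Fin.eq_self_or_eq_succAbove a j with rfl | ⟨i, rfl⟩
    · simp [ha, Fin.succAbove_ne]
    · simp
  have hB : B.card = k + 1 := (Finset.card_map _).symm.trans hC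
  have hne : B.Nonempty := Finset.card_pos.1 (by omega)
  exact ⟨B.min' hne, B, hB, (face_mem_openStar_iff a t B).1 ht, B.isLeast_min' hne⟩

end Stars

/-! ### The two-skeleton of the singular complex -/

section Skeleton

variable {X : Type u} [TopologicalSpace X] {A : Type v} [AddCommGroup A] {n k : ℕ}

variable (X) in
/-- The disjoint union of simplices of dimension at most two, one for each singular simplex. -/
abbrev PreSkeleton : Type u :=
  Σ s : (Σ n : {n : ℕ // n ≤ 2}, C(Simplex n, X)), Simplex s.1

variable (X) in
/-- The gluing relation of the two-skeleton: a face of a singular simplex is identified with the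
simplex belonging to that face. -/
inductive SkeletonRel : PreSkeleton X → PreSkeleton X → Prop
  | face (n : ℕ) (h : n + 1 ≤ 2) (a : Fin (n + 2)) (σ : C(Simplex (n + 1), X)) (t : Simplex n) :
      SkeletonRel ⟨⟨⟨n + 1, h⟩, σ⟩, face a t⟩
        ⟨⟨⟨n, n.le_succ.trans h⟩, σ.comp (TCWeight.face a)⟩, t⟩

variable (X) in
/-- The geometric realization of the two-skeleton of the singular complex of `X`, as a
semisimplicial set. -/
def Skeleton : Type u := Quot (SkeletonRel X)

instance : TopologicalSpace (Skeleton X) := inferInstanceAs (TopologicalSpace (Quot (SkeletonRel X)))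

variable (X) in
/-- The quotient map onto the two-skeleton. -/
def skeletonMk (p : PreSkeleton X) : Skeleton X := Quot.mk _ p

theorem isQuotientMap_skeletonMk : IsQuotientMap (skeletonMk X) := isQuotientMap_quot_mk

/-- The cell of the two-skeleton that belongs to a singular simplex. -/
def cell (h : n ≤ 2) (σ : C(Simplex n, X)) : C(Simplex n, Skeleton X) where
  toFun t := skeletonMk X ⟨⟨⟨n, h⟩, σ⟩, t⟩
  continuous_toFun := isQuotientMap_skeletonMk.continuous.comp continuous_sigmaMk

theorem cell_face (h : n + 1 ≤ 2) (σ : C(Simplex (n + 1), X)) (a : Fin (n + 2)) :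
    (cell h σ).comp (face a) = cell (n.le_succ.trans h) (σ.comp (face a)) :=
  ContinuousMap.ext fun t => Quot.sound (SkeletonRel.face n h a σ t)

theorem skeleton_cases (y : Skeleton X) :
    ∃ (n : ℕ) (h : n ≤ 2) (σ : C(Simplex n, X)) (t : Simplex n), y = cell h σ t := by
  obtain ⟨⟨⟨⟨n, h⟩, σ⟩, t⟩, rfl⟩ := Quot.exists_rep y
  exact ⟨n, h, σ, t, rfl⟩

theorem continuous_skeleton {Z : Type*} [TopologicalSpace Z] {f : Skeleton X → Z}
    (hf : ∀ (n : ℕ) (h : n ≤ 2) (σ : C(Simplex n, X)), Continuous (f ∘ cell h σ)) :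
    Continuous f :=
  isQuotientMap_skeletonMk.continuous_iff.2 <| continuous_sigma fun ⟨⟨n, h⟩, σ⟩ => hf n h σ

variable (X) in
/-- The canonical map from the two-skeleton to `X`. -/
def skeletonMap : C(Skeleton X, X) where
  toFun := Quot.lift (fun p => p.1.2 p.2) (by rintro _ _ ⟨⟩; rfl)
  continuous_toFun := continuous_skeleton fun _ _ σ => σ.continuous

theorem basePoint_simplex (σ : C(Simplex n, X)) (s t : Simplex n) :
    basePoint (σ s) = basePoint (σ t) :=
  basePoint_eq ((PathConnectedSpace.joined s t).map σ.continuous)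

variable (X) in
/-- The map from the two-skeleton to `X × X` whose first component is the base point of the path
component. -/
def basedSkeletonMap : C(Skeleton X, X × X) where
  toFun y := (basePoint (skeletonMap X y), skeletonMap X y)
  continuous_toFun := by
    -- The choice of base point is constant on each cell, hence continuous on the skeleton even if
    -- path components of `X` are not open.
    refine Continuous.prodMk (continuous_skeleton fun n h σ => ?_) (skeletonMap X).continuous
    exact continuous_const.congr fun t => basePoint_simplex σ (vtx 0) t

theorem seg_eq_affineSimplex (p q : Simplex n) (t : unitInterval) :
    seg p q t = affineSimplex ![p, q] (unitPoint t) := by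
  ext i
  rw [seg_apply, affineSimplex_apply, Fin.sum_univ_two]
  change _ = (1 - (t : ℝ)) * p i + t * q i
  ring

theorem simplexMap_seg {m : ℕ} (g : Fin (m + 1) → Fin (n + 1)) (p q : Simplex m)
    (t : unitInterval) : simplexMap g (seg p q t) = seg (simplexMap g p) (simplexMap g q) t := by
  have h : (fun i => simplexMap g (![p, q] i)) = ![simplexMap g p, simplexMap g q] := by
    funext i
    fin_cases i <;> rfl
  rw [seg_eq_affineSimplex, seg_eq_affineSimplex, ← h, ← simplexMap_affineSimplex]
  rfl

theorem continuous_seg (p : Simplex n) :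
    Continuous fun z : Simplex n × unitInterval => seg p z.1 z.2 := by
  refine Continuous.subtype_mk ?_ _
  simp only [AffineMap.lineMap_apply_module]
  fun_prop

/-- The image under a singular simplex of the segment from a vertex to a point. -/
def segmentPath (σ : C(Simplex n, X)) (i : Fin (n + 1)) (t : Simplex n) :
    Path (σ (vtx i)) (σ t) where
  toFun s := σ (seg (vtx i) t s)
  continuous_toFun := σ.continuous.comp
    ((continuous_seg (vtx i)).comp (continuous_const.prodMk continuous_id))
  source' := congrArg σ (seg_zero _ _)
  target' := congrArg σ (seg_one _ _)

/-- The path from the base point to `σ t` through the `i`-th vertex of `σ`. -/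
def vertexPath (σ : C(Simplex n, X)) (i : Fin (n + 1)) (t : Simplex n) : PathSpace X :=
  ((basePath (σ (vtx i))).trans (segmentPath σ i t)).toContinuousMap

theorem endpoints_vertexPath (σ : C(Simplex n, X)) (i : Fin (n + 1)) (t : Simplex n) :
    endpoints (vertexPath σ i t) = (basePoint (σ t), σ t) :=
  Prod.ext (((basePath _).trans _).source.trans (basePoint_simplex σ _ _))
    ((basePath _).trans _).target

theorem continuous_vertexPath (σ : C(Simplex n, X)) (i : Fin (n + 1)) :
    Continuous (vertexPath σ i) := by
  have h := Path.trans_continuous_family (fun _ : Simplex n => basePath (σ (vtx i)))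
    (by
      change Continuous fun z : Simplex n × unitInterval => basePath (σ (vtx i)) z.2
      fun_prop)
    (fun t => segmentPath σ i t) (σ.continuous.comp (continuous_seg (vtx i)))
  exact (ContinuousMap.curry ⟨_, h⟩).continuous

/-- Paths with propositionally equal end points have different types; they are compared as maps on
the interval. -/
theorem basePath_trans_congr {x x' y y' : X} (hx : x = x') (hy : y = y') (p : Path x y)
    (p' : Path x' y') (h : ∀ s, p s = p' s) :
    ((basePath x).trans p).toContinuousMap = ((basePath x').trans p').toContinuousMap := by
  subst hx hy
  obtain rfl : p = p' := Path.ext (funext h)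
  rfl

theorem vertexPath_face (σ : C(Simplex (n + 1), X)) (a : Fin (n + 2)) (i : Fin (n + 1))
    (t : Simplex n) :
    vertexPath σ (a.succAbove i) (face a t) = vertexPath (σ.comp (face a)) i t := by
  have hv : face a (vtx i) = vtx (a.succAbove i) := simplexMap_vtx a.succAbove i
  refine basePath_trans_congr (congrArg σ hv.symm) rfl _ _ fun s => congrArg σ ?_
  rw [← hv]
  exact (simplexMap_seg a.succAbove (vtx i) t s).symm

variable (X) in
/-- The union of the open stars of the barycenters of the `k`-dimensional cells. -/
def starNhd (k : ℕ) : Set (Skeleton X) :=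
  Set.ofPred <| Quot.lift (fun p => ∃ i, IsStarIndex k p.2 i) <| by
    rintro _ _ ⟨n, h, a, σ, t⟩
    exact propext ⟨fun ⟨_, hj⟩ => hj.of_face, fun ⟨_, hi⟩ => ⟨_, hi.face a⟩⟩

theorem isOpen_starNhd : IsOpen (starNhd X k) := by
  rw [← isQuotientMap_skeletonMk.isOpen_preimage, isOpen_sigma_iff]
  rintro ⟨⟨n, h⟩, σ⟩
  have : Sigma.mk ⟨⟨n, h⟩, σ⟩ ⁻¹' (skeletonMk X ⁻¹' starNhd X k) =
      ⋃ i, {t : Simplex n | IsStarIndex k t i} := by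
    ext t
    rw [mem_iUnion]
    rfl
  rw [this]
  exact isOpen_iUnion fun i => isOpen_isStarIndex i

open Classical in
/-- A path from the base point to `σ t`, through the centre of the star that contains `t` if there
is one. -/
def preStarPath (k : ℕ) (σ : C(Simplex n, X)) (t : Simplex n) : PathSpace X :=
  -- The value off the stars carries no information, but it is compatible with faces, so the
  -- definition descends to the quotient.
  if h : ∃ i, IsStarIndex k t i then vertexPath σ h.choose t else .const _ (σ t)

theorem preStarPath_eq {σ : C(Simplex n, X)} {t : Simplex n} {i : Fin (n + 1)}
    (h : IsStarIndex k t i) : preStarPath k σ t = vertexPath σ i t := by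
  have h' : ∃ i, IsStarIndex k t i := ⟨i, h⟩
  rw [preStarPath, dif_pos h', h'.choose_spec.unique h]

/-- The section over the stars: paths from the base point through the centre of the star. -/
def starPath (k : ℕ) : Skeleton X → PathSpace X :=
  Quot.lift (fun p => preStarPath k p.1.2 p.2) <| by
    rintro _ _ ⟨n, h, a, σ, t⟩
    change preStarPath k σ (face a t) = preStarPath k (σ.comp (face a)) t
    by_cases ht : ∃ i, IsStarIndex k t i
    · obtain ⟨i, hi⟩ := ht
      rw [preStarPath_eq hi, preStarPath_eq (hi.face a), vertexPath_face]
    · have ht' : ¬ ∃ i, IsStarIndex k (face a t) i := fun ⟨_, hi⟩ => ht hi.of_face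
      rw [preStarPath, preStarPath, dif_neg ht, dif_neg ht']
      rfl

theorem endpoints_starPath {y : Skeleton X} (hy : y ∈ starNhd X k) :
    endpoints (starPath k y) = basedSkeletonMap X y := by
  obtain ⟨n, h, σ, t, rfl⟩ := skeleton_cases y
  obtain ⟨i, hi⟩ := hy
  change endpoints (preStarPath k σ t) = _
  rw [preStarPath_eq hi]
  exact endpoints_vertexPath σ i t

/-- The star index is locally constant, so within a cell the section is locally `vertexPath` through
a fixed vertex. -/
theorem continuousOn_starPath : ContinuousOn (starPath k) (starNhd X k) := by
  rw [isQuotientMap_skeletonMk.continuousOn_isOpen_iff isOpen_starNhd]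
  rintro ⟨⟨⟨n, h⟩, σ⟩, t⟩ ⟨i, hi⟩
  refine ContinuousAt.continuousWithinAt ?_
  rw [← IsOpenEmbedding.sigmaMk.continuousAt_iff]
  refine (continuous_vertexPath σ i).continuousAt.congr ?_
  filter_upwards [(isOpen_isStarIndex i).mem_nhds hi] with s hs
  exact (preStarPath_eq hs).symm

/-- The cells of the skeleton are themselves singular simplices, so a primitive of the pulled-back
class, evaluated on them, is a cochain on `X`. -/
theorem mem_coboundaries_of_vanishesOnCovers (hk : 3 ≤ k) (c : cocycles X A 2)
    (h : VanishesOnCovers (cohomologyClass 2 (zeroDivisor c)) k) :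
    (c : Cochain 2 X A) ∈ coboundaries X A 2 := by
  have h' := h (Skeleton X) (basedSkeletonMap X) (fun i => starNhd X i) (fun _ => isOpen_starNhd)
    (eq_univ_of_forall fun y => by
      obtain ⟨n, hn, σ, t, rfl⟩ := skeleton_cases y
      obtain ⟨l, hl, hi⟩ := exists_isStarIndex t
      -- Every point lies in a star with `l ≤ 2`, so three sets already cover and the remaining ones
      -- do no harm.
      exact mem_iUnion.2 ⟨⟨l, by omega⟩, hi⟩)
    fun i => ⟨⟨_, continuousOn_starPath.domRestrict⟩, fun y => endpoints_starPath y.2⟩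
  obtain ⟨e, he⟩ := (cohomologyMap_class_eq_zero_iff _ _).1 h'
  let C (x : X) : A := (c : Cochain 2 X A) (.const _ (basePoint x))
  -- On cells, `e` is a primitive of `c` minus its value on the constant simplex at the base point.
  -- Since `C` is constant along each simplex, the alternating sum over three faces leaves one copy
  -- of it, which restores the missing term.
  refine ⟨fun τ => e (cell one_le_two τ) + C (τ (vtx 0)), funext fun σ => ?_⟩
  have e₁ := congrFun he (cell le_rfl σ)
  have e₂ : cochainMap 2 (basedSkeletonMap X) (zeroDivisor c : Cochain 2 (X × X) A)
      (cell le_rfl σ) = (c : Cochain 2 X A) σ - C (σ (vtx 0)) := by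
    have hb : ContinuousMap.fst.comp ((basedSkeletonMap X).comp (cell le_rfl σ)) =
        .const _ (basePoint (σ (vtx 0))) :=
      ContinuousMap.ext fun t => basePoint_simplex σ t (vtx 0)
    change (c : Cochain 2 X A) σ - (c : Cochain 2 X A)
      (ContinuousMap.fst.comp ((basedSkeletonMap X).comp (cell le_rfl σ))) = _
    rw [hb]
  have e₃ (a : Fin 3) : C (σ.comp (face a) (vtx 0)) = C (σ (vtx 0)) := by
    change (c : Cochain 2 X A) (.const _ (basePoint (σ (face a (vtx 0))))) = _
    rw [basePoint_simplex σ _ (vtx 0)]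
  rw [e₂, coboundary_apply] at e₁
  rw [coboundary_apply]
  simp only [smul_add, Finset.sum_add_distrib, e₃]
  simp only [cell_face (le_refl 2)] at e₁
  rw [e₁, Fin.sum_univ_three]
  simp

end Skeleton

/-! ### The TC-weight -/

section Main

variable {X : Type u} [TopologicalSpace X] {A : Type v} [AddCommGroup A]

theorem cohomologyClass_zeroDivisor_eq_zero {n : ℕ} (c : cocycles X A n)
    (hc : (c : Cochain n X A) ∈ coboundaries X A n) :
    cohomologyClass n (zeroDivisor c) = 0 :=
  cohomologyClass_eq_zero_iff.2 <| sub_mem (cochainMap_mem_coboundaries n ContinuousMap.snd hc)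
    (cochainMap_mem_coboundaries n ContinuousMap.fst hc)

end Main

end

end TCWeight

theorem mainTheorem3 {X : Type*} [TopologicalSpace X] {A : Type*} [AddCommGroup A]
    (c : TCWeight.cocycles X A 2)
    (hc : TCWeight.IsAtoroidal (TCWeight.cohomologyClass 2 c)) :
    (∃ h : TCWeight.loopCochain (c : TCWeight.Cochain 2 X A) ∈
          TCWeight.cocycles (TCWeight.LoopSpace X) A 1,
        TCWeight.cohomologyClass 1 ⟨TCWeight.loopCochain (c : TCWeight.Cochain 2 X A), h⟩ = 0) ∧
      TCWeight.cohomologyMap 2 (TCWeight.joinProj X)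
        (TCWeight.cohomologyClass 2 (TCWeight.zeroDivisor c)) = 0 ∧
      2 ≤ TCWeight.tcWeight (TCWeight.cohomologyClass 2 (TCWeight.zeroDivisor c)) ∧
      (TCWeight.cohomologyClass 2 (TCWeight.zeroDivisor c) ≠ 0 →
        TCWeight.tcWeight (TCWeight.cohomologyClass 2 (TCWeight.zeroDivisor c)) = 2) := by
  have hl := TCWeight.loopCochain_mem_coboundaries c hc
  have h2 := TCWeight.vanishesOnCovers_two c hl
  have hle : 2 ≤ TCWeight.tcWeight (TCWeight.cohomologyClass 2 (TCWeight.zeroDivisor c)) :=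
    le_iSup₂_of_le 2 h2 le_rfl
  refine ⟨⟨TCWeight.loopCochain_mem_cocycles c.2, TCWeight.cohomologyClass_eq_zero_iff.2 hl⟩,
    TCWeight.cohomologyMap_joinProj_eq_zero h2, hle, fun hne => le_antisymm ?_ hle⟩
  refine iSup₂_le fun k hk => ?_
  by_contra hlt
  have hk3 : 3 ≤ k := by
    by_contra h3
    exact hlt (by exact_mod_cast (by omega : k ≤ 2))
  exact hne (TCWeight.cohomologyClass_zeroDivisor_eq_zero c
    (TCWeight.mem_coboundaries_of_vanishesOnCovers hk3 c hk))
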